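/- Let $n\in\mathbb N$, let $m_0,\dots,m_n\ge 1$ be integers, let $\mathfrak A=\bigoplus_{l=0}^n M_{m_l}(\mathbb C)$ with its C*-norm, and let $m_{\mathfrak A}=\max_l m_l$. For $a=(a^l_{j,k})\in\mathfrak A$ put $\|a\|_{\infty,\mathfrak A_{\mathbb R}}=\max_{l,j,k}\max\{|\operatorname{Re}a^l_{j,k}|,|\operatorname{Im}a^l_{j,k}|\}$. For a (nonempty) compact metric space $(X,d_X)$ and a self-adjoint $a\in C(X,\mathfrak A)$ let $$\mathsf L_X(a)=\max\Big\{\sup_{x\ne y}\frac{\|a(x)-a(y)\|_{\infty,\mathfrak A_{\mathbb R}}}{d_X(x,y)},\ \inf_{r\in\mathbb R}\sup_{x\in X}\|a(x)-r1_{\mathfrak A}\|_{\infty,\mathfrak A_{\mathbb R}}\Big\}\in[0,\infty].$$ Definitions. A compact quantum metric space $(\mathfrak B,\mathsf L)$ is a nonzero unital C*-algebra $\mathfrak B$ with a lower semicontinuous $[0,\infty]$-valued real seminorm $\mathsf L$ on its self-adjoint part $\mathfrak{sa}(\mathfrak B)$, finite on a dense subspace, with $\{\mathsf L=0\}=\mathbb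 R1$, such that $\mathsf{mk}_{\mathsf L}(\varphi,\psi)=\sup\{|\varphi(a)-\psi(a)|:a\in\mathfrak{sa}(\mathfrak B),\ \mathsf L(a)\le1\}$ metrizes the weak* topology of the state space $\mathscr S(\mathfrak B)$. It is $(C,D)$-quasi-Leibniz, for $C\ge1$, $D\ge0$, if $\max\{\mathsf L(\frac{ab+ba}2),\mathsf L(\frac{ab-ba}{2i})\}\le C(\|a\|\mathsf L(b)+\|b\|\mathsf L(a))+D\,\mathsf L(a)\mathsf L(b)$ whenever $\mathsf L(a),\mathsf L(b)<\infty$; $\mathrm{qLCQMS}$ is the class of all such spaces, for all $C,D$. Two of them are quantum isometric if there is a *-isomorphism $\pi$ with $\mathsf L_2\circ\pi=\mathsf L_1$. A bridge from $\mathfrak B_1$ to $\mathfrak B_2$ is a tuple $\gamma=(\mathfrak D,\omega,\rho_1,\rho_2)$ of a unital C*-algebra $\mathfrak D$, unital *-monomorphisms $\rho_i:\mathfrak B_i\to\mathfrak D$, and $\omega\in\mathfrak D$ such that $\mathscr S_1(\omega)=\{\varphi\in\mathscr S(\mathfrak D):\varphi((1-\omega)^*(1-\omega))=\varphi((1-\omega)(1-\omega)^*)=0\}$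 is nonempty. Its length is the maximum of its reach, the Hausdorff distance in $\mathfrak D$ between $\{\rho_1(a)\omega:\mathsf L_1(a)\le1\}$ and $\{\omega\rho_2(b):\mathsf L_2(b)\le1\}$, and its height, the larger of the Hausdorff distances for $\mathsf{mk}_{\mathsf L_i}$ between $\mathscr S(\mathfrak B_i)$ and $\{\varphi\circ\rho_i:\varphi\in\mathscr S_1(\omega)\}$, $i=1,2$. The quantum Gromov–Hausdorff propinquity $\Lambda$ between two elements of $\mathrm{qLCQMS}$ is the infimum, over all finite chains of bridges joining them through elements of $\mathrm{qLCQMS}$, of the sum of the lengths of the bridges. Let $\mathrm{GH}$ be the Gromov–Hausdorff distance. Theorem. For every compact metric space $X$, $(C(X,\mathfrak A),\mathsf L_X)$ is a $(\sqrt2\,m_{\mathfrak A},0)$-quasi-Leibniz compact quantum metric space. The map $$\Gamma^{\mathfrak A}:(X,d_X)\longmapsto(C(X,\mathfrak A),\mathsf L_X)$$ is well defined from isometry classes of compact metric spaces to quantum isometry classes of quasi-Leibniz compact quantum metric spaces, and it is continuous when the former are topologized by $\mathrm{GH}$ and the latter carry the quotient topology induced by $\Lambda$. In particular, for all compact metric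 spaces $X,Y$, $$\Lambda\big((C(X,\mathfrak A),\mathsf L_X),(C(Y,\mathfrak A),\mathsf L_Y)\big)\le\sqrt2\cdot m_{\mathfrak A}\cdot\mathrm{GH}(X,Y).$$ -/

import Mathlib

open scoped ENNReal Topology ComplexOrder Matrix.Norms.L2Operator

universe u

namespace QPropinquity

/-! ### States and the Monge-Kantorovich metric -/

/-- The states of a unital C*-algebra: the positive unital continuous linear functionals.
As a subset of `WeakDual ℂ A` it carries the weak* topology. -/
def stateSpace (A : Type u) [CStarAlgebra A] : Set (WeakDual ℂ A) :=
  {φ | φ 1 = 1 ∧ ∀ a : A, 0 ≤ φ (star a * a)}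

/-- The Monge-Kantorovich (extended) distance of a `[0, ∞]`-valued seminorm `L` on the
self-adjoint elements. -/
noncomputable def mkDist {A : Type u} [CStarAlgebra A] (L : selfAdjoint A → ℝ≥0∞)
    (φ ψ : WeakDual ℂ A) : ℝ≥0∞ :=
  ⨆ (a : selfAdjoint A) (_ : L a ≤ 1), ‖φ (a : A) - ψ (a : A)‖ₑ

/-- The Jordan product `(ab + ba) / 2` of self-adjoint elements. -/
noncomputable def jordanMul {A : Type u} [CStarAlgebra A] (a b : selfAdjoint A) :
    selfAdjoint A :=
  ⟨(1 / 2 : ℂ) • ((a : A) * b + b * a), by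
    have ha : star (a : A) = a := a.2
    have hb : star (b : A) = b := b.2
    rw [selfAdjoint.mem_iff, star_smul, star_add, star_mul, star_mul, ha, hb,
      add_comm ((b : A) * a)]
    simp⟩

/-- The Lie product `(ab - ba) / (2i)` of self-adjoint elements. -/
noncomputable def lieMul {A : Type u} [CStarAlgebra A] (a b : selfAdjoint A) :
    selfAdjoint A :=
  ⟨(1 / (2 * Complex.I) : ℂ) • ((a : A) * b - b * a), by
    have ha : star (a : A) = a := a.2
    have hb : star (b : A) = b := b.2
    have hc : star (1 / (2 * Complex.I) : ℂ) = -(1 / (2 * Complex.I)) := by simp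
    rw [selfAdjoint.mem_iff, star_smul, star_sub, star_mul, star_mul, ha, hb, hc, neg_smul,
      ← smul_neg, neg_sub]⟩

/-! ### Quasi-Leibniz compact quantum metric spaces -/

/-- `(A, L)` is a compact quantum metric space: `A` is a nonzero unital C*-algebra, and `L` is a
lower semicontinuous seminorm over `ℝ` on the self-adjoint elements, allowed to take the value `∞`,
finite on a dense subspace, vanishing exactly on `ℝ1`, whose Monge-Kantorovich metric induces the
weak* topology of the state space. -/
structure IsCompactQuantumMetric (A : Type u) [CStarAlgebra A] (L : selfAdjoint A → ℝ≥0∞) :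
    Prop where
  nontrivial : Nontrivial A
  add_le : ∀ a b : selfAdjoint A, L (a + b) ≤ L a + L b
  smul : ∀ (r : ℝ) (a : selfAdjoint A), L (r • a) = ‖r‖ₑ * L a
  dense_dom : Dense {a : selfAdjoint A | L a < ∞}
  eq_zero_iff : ∀ a : selfAdjoint A, L a = 0 ↔ ∃ r : ℝ, a = r • (1 : selfAdjoint A)
  metrizes : ∀ φ : stateSpace A,
    (𝓝 φ).HasBasis (fun ε : ℝ≥0∞ => 0 < ε) (fun ε => {ψ : stateSpace A | mkDist L φ ψ < ε})
  lsc : LowerSemicontinuous L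

/-- `(A, L)` is a `(C, D)`-quasi-Leibniz compact quantum metric space. -/
structure IsQuasiLeibnizCQMS (A : Type u) [CStarAlgebra A] (C D : ℝ)
    (L : selfAdjoint A → ℝ≥0∞) : Prop where
  isCompactQuantumMetric : IsCompactQuantumMetric A L
  one_le : 1 ≤ C
  nonneg : 0 ≤ D
  quasiLeibniz : ∀ a b : selfAdjoint A, L a < ∞ → L b < ∞ →
    max (L (jordanMul a b)) (L (lieMul a b)) ≤
      ENNReal.ofReal C * (‖(a : A)‖ₑ * L b + ‖(b : A)‖ₑ * L a) + ENNReal.ofReal D * L a * L b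

/-- The class `qLCQMS` of all quasi-Leibniz compact quantum metric spaces. -/
structure QLCQMS : Type (u + 1) where
  carrier : Type u
  [cstar : CStarAlgebra carrier]
  L : selfAdjoint carrier → ℝ≥0∞
  isQL : ∃ C D : ℝ, IsQuasiLeibnizCQMS carrier C D L

attribute [instance] QLCQMS.cstar

/-! ### Bridges, treks and the quantum Gromov-Hausdorff propinquity -/

/-- The 1-level set of `ω`: the states `φ` with `φ((1 - ω)*(1 - ω)) = φ((1 - ω)(1 - ω)*) = 0`. -/
def levelSet {D : Type u} [CStarAlgebra D] (ω : D) : Set (WeakDual ℂ D) :=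
  {φ | φ ∈ stateSpace D ∧ φ (star (1 - ω) * (1 - ω)) = 0 ∧ φ ((1 - ω) * star (1 - ω)) = 0}

/-- A bridge from `A` to `B`: a unital C*-algebra `D`, a pivot `ω ∈ D` with nonempty 1-level set,
and unital *-monomorphisms from `A` and `B` to `D`. -/
structure Bridge (A B : Type u) [CStarAlgebra A] [CStarAlgebra B] : Type (u + 1) where
  D : Type u
  [cstar : CStarAlgebra D]
  pivot : D
  left : A →⋆ₐ[ℂ] D
  right : B →⋆ₐ[ℂ] D
  left_injective : Function.Injective left
  right_injective : Function.Injective right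
  levelSet_nonempty : (levelSet pivot).Nonempty

attribute [instance] Bridge.cstar

/-- The Hausdorff distance between two sets for a `[0, ∞]`-valued distance function `d`. -/
noncomputable def hausdorffOf {α : Type u} (d : α → α → ℝ≥0∞) (s t : Set α) : ℝ≥0∞ :=
  max (⨆ x ∈ s, ⨅ y ∈ t, d x y) (⨆ y ∈ t, ⨅ x ∈ s, d x y)

/-- The reach of a bridge: the Hausdorff distance in `D` between `{a ω : L_A(a) ≤ 1}` and
`{ω b : L_B(b) ≤ 1}`. -/
noncomputable def Bridge.reach {A B : Type u} [CStarAlgebra A] [CStarAlgebra B] (γ : Bridge A B)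
    (LA : selfAdjoint A → ℝ≥0∞) (LB : selfAdjoint B → ℝ≥0∞) : ℝ≥0∞ :=
  hausdorffOf (fun x y : γ.D => edist x y)
    {x | ∃ a : selfAdjoint A, LA a ≤ 1 ∧ x = γ.left a * γ.pivot}
    {y | ∃ b : selfAdjoint B, LB b ≤ 1 ∧ y = γ.pivot * γ.right b}

/-- The height of a bridge: the larger of the Hausdorff distances, for the Monge-Kantorovich
metrics, between the state spaces of `A` and `B` and the sets of states obtained by composing the
states of the 1-level set of the pivot with the two *-monomorphisms. -/
noncomputable def Bridge.height {A B : Type u} [CStarAlgebra A] [CStarAlgebra B] (γ : Bridge A B)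
    (LA : selfAdjoint A → ℝ≥0∞) (LB : selfAdjoint B → ℝ≥0∞) : ℝ≥0∞ :=
  max
    (hausdorffOf (mkDist LA) (stateSpace A)
      {ψ | ∃ φ ∈ levelSet γ.pivot, ∀ a : A, ψ a = φ (γ.left a)})
    (hausdorffOf (mkDist LB) (stateSpace B)
      {ψ | ∃ φ ∈ levelSet γ.pivot, ∀ b : B, ψ b = φ (γ.right b)})

/-- The length of a bridge. -/
noncomputable def Bridge.length {A B : Type u} [CStarAlgebra A] [CStarAlgebra B] (γ : Bridge A B)
    (LA : selfAdjoint A → ℝ≥0∞) (LB : selfAdjoint B → ℝ≥0∞) : ℝ≥0∞ :=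
  max (γ.reach LA LB) (γ.height LA LB)

/-- A trek: a finite nonempty chain of bridges through quasi-Leibniz compact quantum metric
spaces. -/
inductive Trek : QLCQMS.{u} → QLCQMS.{u} → Type (u + 1)
  | single {P Q : QLCQMS.{u}} (γ : Bridge P.carrier Q.carrier) : Trek P Q
  | cons {P Q R : QLCQMS.{u}} (γ : Bridge P.carrier Q.carrier) (τ : Trek Q R) : Trek P R

/-- The length of a trek: the sum of the lengths of its bridges. -/
noncomputable def Trek.length : {P Q : QLCQMS.{u}} → Trek P Q → ℝ≥0∞
  | P, Q, .single γ => γ.length P.L Q.L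
  | P, _, .cons (Q := Q) γ τ => γ.length P.L Q.L + τ.length

/-- The quantum Gromov-Hausdorff propinquity: the infimum of the lengths of treks. -/
noncomputable def propinquity (P Q : QLCQMS.{u}) : ℝ≥0∞ :=
  ⨅ τ : Trek P Q, τ.length

/-! ### Quantum isometry classes and their topology -/

/-- Quantum isometry: a *-isomorphism `π` with `L_B ∘ π = L_A`. -/
def QuantumIsometric (P Q : QLCQMS.{u}) : Prop :=
  ∃ π : P.carrier ≃⋆ₐ[ℂ] Q.carrier, ∀ a : selfAdjoint P.carrier,
    Q.L ⟨π a, IsSelfAdjoint.map a.2 π⟩ = P.L a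

theorem quantumIsometric_equivalence : Equivalence QuantumIsometric.{u} where
  refl _ := ⟨StarAlgEquiv.refl _ _, fun _ => rfl⟩
  symm := by
    rintro P Q ⟨π, h⟩
    refine ⟨π.symm, fun b => ?_⟩
    rw [← h]
    congr 1
    exact Subtype.ext (π.apply_symm_apply (b : Q.carrier))
  trans := by
    rintro P Q R ⟨π, h⟩ ⟨ρ, k⟩
    exact ⟨π.trans ρ, fun a => (k ⟨π a, IsSelfAdjoint.map a.2 π⟩).trans (h a)⟩

instance quantumIsometrySetoid : Setoid QLCQMS.{u} :=
  ⟨QuantumIsometric, quantumIsometric_equivalence⟩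

/-- The topology of the propinquity: a set is open if with each point it contains a ball. -/
instance propinquityTopology : TopologicalSpace QLCQMS.{u} where
  IsOpen U := ∀ P ∈ U, ∃ ε : ℝ≥0∞, 0 < ε ∧ ∀ Q, propinquity P Q < ε → Q ∈ U
  isOpen_univ := fun _ _ => ⟨1, one_pos, fun _ _ => trivial⟩
  isOpen_inter := by
    rintro U V hU hV P ⟨hPU, hPV⟩
    obtain ⟨ε, hε, h⟩ := hU P hPU
    obtain ⟨δ, hδ, k⟩ := hV P hPV
    exact ⟨min ε δ, lt_min hε hδ, fun Q hQ =>
      ⟨h Q (hQ.trans_le (min_le_left _ _)), k Q (hQ.trans_le (min_le_right _ _))⟩⟩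
  isOpen_sUnion := by
    rintro S hS P ⟨U, hU, hP⟩
    obtain ⟨ε, hε, h⟩ := hS U hU P hP
    exact ⟨ε, hε, fun Q hQ => ⟨U, hU, h Q hQ⟩⟩

/-- The space of quantum isometry classes, with the quotient topology. -/
abbrev QLCQMSClass : Type (u + 1) := Quotient quantumIsometrySetoid.{u}

/-! ### The algebras `C(X, 𝔄)` and their Lip-norms -/

/-- The finite-dimensional C*-algebra `⊕ M_{m l}(ℂ)`, `l = 0, …, n`, where each matrix algebra has
the operator norm for the Euclidean norm on `ℂ ^ (m l)`. -/
abbrev FDAlg {n : ℕ} (m : Fin (n + 1) → ℕ) : Type :=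
  ∀ l : Fin (n + 1), Matrix (Fin (m l)) (Fin (m l)) ℂ

/-- The largest block size. -/
def maxSize {n : ℕ} (m : Fin (n + 1) → ℕ) : ℕ := Finset.univ.sup m

/-- The largest absolute value of the real and imaginary parts of the matrix entries of `a`. -/
noncomputable def realMaxNorm {n : ℕ} {m : Fin (n + 1) → ℕ} (a : FDAlg m) : ℝ≥0∞ :=
  ⨆ (l : Fin (n + 1)) (j : Fin (m l)) (k : Fin (m l)),
    ENNReal.ofReal (max |(a l j k).re| |(a l j k).im|)

/-- The seminorm
`max {sup_{x ≠ y} ‖a(x) - a(y)‖ / d(x, y), inf_{r ∈ ℝ} sup_x ‖a(x) - r1‖}`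
on the self-adjoint elements of `C(X, 𝔄)`, where `‖·‖` is `realMaxNorm`. -/
noncomputable def lipNorm {n : ℕ} (m : Fin (n + 1) → ℕ) (X : Type u) [MetricSpace X]
    [CompactSpace X] (a : selfAdjoint C(X, FDAlg m)) : ℝ≥0∞ :=
  max
    (⨆ (x : X) (y : X) (_ : x ≠ y),
      realMaxNorm ((a : C(X, FDAlg m)) x - (a : C(X, FDAlg m)) y) / edist x y)
    (⨅ r : ℝ, ⨆ x : X, realMaxNorm ((a : C(X, FDAlg m)) x - r • (1 : FDAlg m)))

/-- The quasi-Leibniz compact quantum metric space formed by a C*-algebra and a quasi-Leibniz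
Lip-norm. -/
def QLCQMS.of {A : Type u} [CStarAlgebra A] {C D : ℝ} {L : selfAdjoint A → ℝ≥0∞}
    (h : IsQuasiLeibnizCQMS A C D L) : QLCQMS.{u} :=
  ⟨A, L, C, D, h⟩

end QPropinquity

/-!
Real and imaginary parts of matrix entries identify `𝔄` with a space `ℝ ^ ι` under the sup norm,
where `‖·‖` is at most `√2 · maxSize m` times the sup norm of the coordinates. The Lip-norm becomes
the Lipschitz seminorm of functions into `ℝ ^ ι`, combined with the distance to the line spanned by
the constant function `1`. Elements of Lip-norm at most `1` are, up to scalars, bounded and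
equi-Lipschitz, so Arzelà-Ascoli and the equicontinuity of states give the metrization of the weak*
topology.

If `X` and `Y` are isometrically embedded in `Z` at Hausdorff distance `δ`, let `W ⊆ X × Y` be the
compact set of pairs at distance at most `δ`. The pullbacks along the two projections make
`C(W, 𝔄)` with pivot `1` a bridge of height zero. Its reach is at most `√2 · maxSize m · δ`: extend
the coordinates of a function on `X` to `Z` by McShane's formula, clamp them to their original range
so that the distance to the scalars does not increase, restrict to `Y`, and take the self-adjoint
part.
-/

namespace QPropinquity

/-! ### States -/

section States

open scoped ComplexStarModule

variable {A : Type u} [CStarAlgebra A]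

theorem exists_star_mul_self_eq_norm_sub {a : A} (ha : IsSelfAdjoint a) :
    ∃ b : A, star b * b = algebraMap ℝ A ‖a‖ - a := by
  let := CStarAlgebra.spectralOrder A
  let := CStarAlgebra.spectralOrderedRing A
  obtain ⟨b, hb⟩ :=
    CStarAlgebra.nonneg_iff_eq_star_mul_self.1 (sub_nonneg.2 ha.le_algebraMap_norm_self)
  exact ⟨b, hb.symm⟩

theorem norm_algebraMap_norm_sub_star_mul_self_le (a : A) :
    ‖algebraMap ℝ A ‖star a * a‖ - star a * a‖ ≤ ‖star a * a‖ := by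
  let := CStarAlgebra.spectralOrder A
  let := CStarAlgebra.spectralOrderedRing A
  have ha : 0 ≤ star a * a := star_mul_self_nonneg a
  have hsub : 0 ≤ algebraMap ℝ A ‖star a * a‖ - star a * a :=
    sub_nonneg.2 (IsSelfAdjoint.of_nonneg ha).le_algebraMap_norm_self
  refine (CStarAlgebra.norm_le_norm_of_nonneg_of_le hsub (sub_le_self _ ha)).trans ?_
  nontriviality A
  rw [norm_algebraMap', norm_norm]

theorem apply_algebraMap_real {φ : WeakDual ℂ A} (h : φ 1 = 1) (r : ℝ) :
    φ (algebraMap ℝ A r) = r := by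
  rw [Algebra.algebraMap_eq_smul_one, ← Complex.coe_smul, map_smul, h, smul_eq_mul, mul_one]

theorem apply_le_norm_of_mem_stateSpace {φ : WeakDual ℂ A} (hφ : φ ∈ stateSpace A) {a : A}
    (ha : IsSelfAdjoint a) : φ a ≤ ‖a‖ := by
  obtain ⟨b, hb⟩ := exists_star_mul_self_eq_norm_sub ha
  have h := hφ.2 b
  rwa [hb, map_sub, apply_algebraMap_real hφ.1, sub_nonneg] at h

theorem isSelfAdjoint_apply_of_mem_stateSpace {φ : WeakDual ℂ A} (hφ : φ ∈ stateSpace A) {a : A}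
    (ha : IsSelfAdjoint a) : IsSelfAdjoint (φ a) := by
  have h := (Complex.le_def.1 (apply_le_norm_of_mem_stateSpace hφ ha)).2
  rw [Complex.ofReal_im] at h
  exact Complex.conj_eq_iff_im.2 h

theorem apply_star_of_mem_stateSpace {φ : WeakDual ℂ A} (hφ : φ ∈ stateSpace A) (a : A) :
    φ (star a) = star (φ a) := by
  have hre := isSelfAdjoint_apply_of_mem_stateSpace hφ (ℜ a).2
  have him := isSelfAdjoint_apply_of_mem_stateSpace hφ (ℑ a).2
  nth_rw 1 2 [← realPart_add_I_smul_imaginaryPart a]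
  simp only [star_add, star_smul, map_add, map_smul, hre.star_eq, him.star_eq,
    selfAdjoint.star_val_eq]

-- The variance `φ((a - φ(a))⋆(a - φ(a))) = φ(a⋆a) - |φ(a)|²` is nonnegative.
theorem norm_apply_le_of_mem_stateSpace {φ : WeakDual ℂ A} (hφ : φ ∈ stateSpace A) (a : A) :
    ‖φ a‖ ≤ ‖a‖ := by
  have hvar : φ (star (a - φ a • 1) * (a - φ a • 1)) = φ (star a * a) - (‖φ a‖ ^ 2 : ℝ) := by
    simp only [star_sub, star_smul, star_one, sub_mul, mul_sub, smul_mul_assoc, mul_smul_comm,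
      one_mul, mul_one, map_sub, map_smul, apply_star_of_mem_stateSpace hφ, hφ.1, smul_eq_mul]
    rw [Complex.ofReal_pow, ← Complex.conj_mul']
    simp only [RCLike.star_def]
    ring
  have hle : ((‖φ a‖ ^ 2 : ℝ) : ℂ) ≤ ‖star a * a‖ :=
    (sub_nonneg.1 (hvar ▸ hφ.2 _)).trans
      (apply_le_norm_of_mem_stateSpace hφ (IsSelfAdjoint.star_mul_self a))
  rw [Complex.real_le_real, CStarRing.norm_star_mul_self, ← sq] at hle
  exact le_of_sq_le_sq hle (norm_nonneg a)

theorem lipschitzWith_one_of_mem_stateSpace {φ : WeakDual ℂ A} (hφ : φ ∈ stateSpace A) :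
    LipschitzWith 1 φ :=
  LipschitzWith.of_dist_le_mul fun a b => by
    simpa [dist_eq_norm] using norm_apply_le_of_mem_stateSpace hφ (a - b)

theorem norm_add_smul_I_sq_le {a : A} (ha : IsSelfAdjoint a) (t : ℝ) :
    ‖a + (t * Complex.I) • (1 : A)‖ ^ 2 ≤ ‖a‖ ^ 2 + t ^ 2 := by
  have hexpand : star (a + (t * Complex.I) • (1 : A)) * (a + (t * Complex.I) • (1 : A)) =
      a * a + ((t : ℂ) ^ 2) • (1 : A) := by
    have hI : star ((t : ℂ) * Complex.I) = -(t * Complex.I) := by simp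
    simp only [star_add, star_smul, ha.star_eq, star_one, hI, add_mul, mul_add, smul_mul_assoc,
      one_mul, mul_smul_comm, mul_one]
    linear_combination (norm := module) -((t : ℂ) ^ 2 * Complex.I_sq) • (1 : A)
  have hone : ‖(1 : A)‖ ≤ 1 := by
    rcases subsingleton_or_nontrivial A with h | h
    · simp [Subsingleton.elim (1 : A) 0]
    · exact CStarRing.norm_one.le
  calc ‖a + (t * Complex.I) • (1 : A)‖ ^ 2
      = ‖a * a + ((t : ℂ) ^ 2) • (1 : A)‖ := by rw [sq, ← CStarRing.norm_star_mul_self, hexpand]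
    _ ≤ ‖a‖ * ‖a‖ + t ^ 2 := by
        refine (norm_add_le _ _).trans (add_le_add (norm_mul_le _ _) ?_)
        rw [norm_smul, norm_pow, Complex.norm_real, Real.norm_eq_abs, sq_abs]
        exact mul_le_of_le_one_right (sq_nonneg t) hone
    _ = ‖a‖ ^ 2 + t ^ 2 := by rw [sq ‖a‖]

theorem im_apply_eq_zero_of_norm_apply_le {φ : WeakDual ℂ A} (hone : φ 1 = 1)
    (hφ : ∀ a, ‖φ a‖ ≤ ‖a‖) {a : A} (ha : IsSelfAdjoint a) : (φ a).im = 0 := by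
  have hlinear (t : ℝ) : 2 * (φ a).im * t ≤ ‖a‖ ^ 2 := by
    have happly : φ (a + (t * Complex.I) • (1 : A)) = φ a + t * Complex.I := by simp [hone]
    have hle : ‖φ a + t * Complex.I‖ ^ 2 ≤ ‖a‖ ^ 2 + t ^ 2 := by
      rw [← happly]
      exact (by gcongr; exact hφ _ : _ ≤ _).trans (norm_add_smul_I_sq_le ha t)
    rw [← Complex.normSq_eq_norm_sq, Complex.normSq_apply] at hle
    simp only [Complex.add_re, Complex.re_ofReal_mul, Complex.I_re, mul_zero, add_zero,
      Complex.add_im, Complex.im_ofReal_mul, Complex.I_im, mul_one] at hle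
    nlinarith [sq_nonneg (φ a).re, sq_nonneg (φ a).im]
  by_contra hne
  have h := hlinear ((‖a‖ ^ 2 + 1) / (2 * (φ a).im))
  rw [mul_div_cancel₀ _ (mul_ne_zero two_ne_zero hne)] at h
  linarith

theorem mem_stateSpace_of_norm_apply_le {φ : WeakDual ℂ A} (hone : φ 1 = 1)
    (hφ : ∀ a, ‖φ a‖ ≤ ‖a‖) : φ ∈ stateSpace A := by
  refine ⟨hone, fun a => Complex.le_def.2 ⟨?_, ?_⟩⟩
  · have h := (hφ _).trans (norm_algebraMap_norm_sub_star_mul_self_le a)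
    rw [map_sub, apply_algebraMap_real hone] at h
    have hre := (le_abs_self _).trans ((Complex.abs_re_le_norm _).trans h)
    rw [Complex.sub_re, Complex.ofReal_re] at hre
    exact (sub_le_self_iff _).1 hre
  · exact (im_apply_eq_zero_of_norm_apply_le hone hφ (IsSelfAdjoint.star_mul_self a)).symm

theorem stateSpace_nonempty [Nontrivial A] : (stateSpace A).Nonempty := by
  obtain ⟨g, hg, hone⟩ := exists_dual_vector ℂ (1 : A) (norm_ne_zero_iff.2 one_ne_zero)
  refine ⟨StrongDual.toWeakDual g, mem_stateSpace_of_norm_apply_le ?_ fun a => ?_⟩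
  · simpa using hone
  · simpa [hg] using g.le_opNorm a

theorem mem_stateSpace_of_apply_eq {B : Type u} [CStarAlgebra B] (ρ : A →⋆ₐ[ℂ] B)
    {φ : WeakDual ℂ B} (hφ : φ ∈ stateSpace B) {ψ : WeakDual ℂ A} (h : ∀ a, ψ a = φ (ρ a)) :
    ψ ∈ stateSpace A := by
  refine ⟨by rw [h, map_one, hφ.1], fun a => ?_⟩
  rw [h, map_mul, map_star]
  exact hφ.2 _

theorem exists_mem_stateSpace_extension {B : Type u} [CStarAlgebra B] (ρ : A →⋆ₐ[ℂ] B)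
    (hρ : Function.Injective ρ) {ψ : WeakDual ℂ A} (hψ : ψ ∈ stateSpace A) :
    ∃ φ ∈ stateSpace B, ∀ a, ψ a = φ (ρ a) := by
  let i : A →ₗᵢ[ℂ] B := ⟨ρ.toAlgHom.toLinearMap, NonUnitalStarAlgHom.norm_map ρ hρ⟩
  let f : StrongDual ℂ i.range :=
    (WeakDual.toStrongDual ψ).comp
      i.equivRange.symm.toContinuousLinearEquiv.toContinuousLinearMap
  obtain ⟨g, hgf, hnorm⟩ := exists_extension_norm_eq _ f
  have hg (a : A) : g (ρ a) = ψ a :=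
    (hgf (i.equivRange a)).trans (congrArg ψ (i.equivRange.symm_apply_apply a))
  have hg_norm : ‖g‖ ≤ 1 := hnorm ▸ f.opNorm_le_bound zero_le_one fun b => by
    rw [one_mul, ← i.equivRange.symm.norm_map b]
    exact norm_apply_le_of_mem_stateSpace hψ _
  refine ⟨StrongDual.toWeakDual g, mem_stateSpace_of_norm_apply_le ?_ fun b => ?_,
    fun a => (hg a).symm⟩
  · exact (congrArg g (map_one ρ)).symm.trans ((hg 1).trans hψ.1)
  · exact (g.le_opNorm b).trans (mul_le_of_le_one_left (norm_nonneg b) hg_norm)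

end States

/-! ### Metrization of the weak* topology -/

section Metrization

open Filter
open scoped ComplexStarModule

variable {A : Type u} [CStarAlgebra A] {L : selfAdjoint A → ℝ≥0∞}

theorem enorm_apply_sub_apply_le_mkDist {a : selfAdjoint A} (ha : L a ≤ 1) (φ ψ : WeakDual ℂ A) :
    ‖φ (a : A) - ψ (a : A)‖ₑ ≤ mkDist L φ ψ :=
  le_iSup₂_of_le a ha le_rfl

theorem enorm_apply_sub_apply_le_mul_mkDist
    (hsmul : ∀ (r : ℝ) (a : selfAdjoint A), L (r • a) = ‖r‖ₑ * L a) {a : selfAdjoint A} {c : ℝ}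
    (hc : 0 < c) (ha : L a ≤ ‖c‖ₑ) (φ ψ : WeakDual ℂ A) :
    ‖φ (a : A) - ψ (a : A)‖ₑ ≤ ‖c‖ₑ * mkDist L φ ψ := by
  have hone : L (c⁻¹ • a) ≤ 1 := by
    rw [hsmul, enorm_inv hc.ne']
    rwa [ENNReal.inv_mul_le_iff (enorm_ne_zero.2 hc.ne') enorm_ne_top, mul_one]
  have hscale (χ : WeakDual ℂ A) : χ (a : A) = c • χ ((c⁻¹ • a : selfAdjoint A) : A) := by
    rw [selfAdjoint.val_smul, ← Complex.coe_smul c⁻¹, map_smul, Complex.coe_smul,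
      smul_inv_smul₀ hc.ne']
  rw [hscale φ, hscale ψ, ← smul_sub, enorm_smul]
  gcongr
  exact enorm_apply_sub_apply_le_mkDist hone φ ψ

theorem uniformEquicontinuous_stateSpace :
    UniformEquicontinuous fun (ψ : stateSpace A) (a : selfAdjoint A) => ψ.1 (a : A) :=
  LipschitzWith.uniformEquicontinuous _ 1 fun ψ a b =>
    lipschitzWith_one_of_mem_stateSpace ψ.2 (a : A) b

theorem tendsto_stateSpace_iff {l : Filter (stateSpace A)} {φ : stateSpace A} :
    Tendsto id l (𝓝 φ) ↔ ∀ a : selfAdjoint A, Tendsto (fun ψ => ψ.1 (a : A)) l (𝓝 (φ.1 a)) := by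
  rw [tendsto_subtype_rng, tendsto_iff_forall_eval_tendsto_topDualPairing]
  refine ⟨fun h a => h a, fun h a => ?_⟩
  have hdecomp (ψ : stateSpace A) :
      ψ.1 (ℜ a : A) + Complex.I * ψ.1 (ℑ a : A) = ψ.1 a := by
    rw [← smul_eq_mul, ← map_smul ψ.1, ← map_add ψ.1, realPart_add_I_smul_imaginaryPart]
  change Tendsto (fun ψ : stateSpace A => ψ.1 a) l (𝓝 (φ.1 a))
  simp only [← hdecomp]
  exact (h (ℜ a)).add ((h (ℑ a)).const_mul Complex.I)

theorem tendsto_of_tendsto_mkDist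
    (hsmul : ∀ (r : ℝ) (a : selfAdjoint A), L (r • a) = ‖r‖ₑ * L a)
    (hdense : Dense {a : selfAdjoint A | L a < ∞}) {l : Filter (stateSpace A)} {φ : stateSpace A}
    (hl : Tendsto (fun ψ : stateSpace A => mkDist L φ ψ) l (𝓝 0)) : Tendsto id l (𝓝 φ) := by
  have hdom (a : selfAdjoint A) (ha : L a < ∞) : Tendsto (fun ψ => ψ.1 (a : A)) l (𝓝 (φ.1 a)) := by
    obtain ⟨c, hc⟩ := ENNReal.exists_nat_gt ha.ne
    have hpos : (0 : ℝ) < c + 1 := by positivity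
    have hle : L a ≤ ‖(c + 1 : ℝ)‖ₑ := by
      rw [Real.enorm_of_nonneg hpos.le, ENNReal.ofReal_add c.cast_nonneg zero_le_one,
        ENNReal.ofReal_natCast]
      exact hc.le.trans le_self_add
    have hbound : Tendsto (fun ψ : stateSpace A => ‖(c + 1 : ℝ)‖ₑ * mkDist L φ ψ) l (𝓝 0) := by
      simpa using ENNReal.Tendsto.const_mul hl (Or.inr enorm_ne_top)
    rw [tendsto_iff_edist_tendsto_0]
    refine tendsto_of_tendsto_of_tendsto_of_le_of_le tendsto_const_nhds hbound
      (fun _ => zero_le) fun ψ => ?_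
    rw [edist_comm, edist_eq_enorm_sub]
    exact enorm_apply_sub_apply_le_mul_mkDist hsmul hpos hle φ.1 ψ.1
  have hclosed : IsClosed {a : selfAdjoint A | Tendsto (fun ψ => ψ.1 (a : A)) l (𝓝 (φ.1 a))} :=
    uniformEquicontinuous_stateSpace.equicontinuous.isClosed_setOfPred_tendsto
      (uniformEquicontinuous_stateSpace.uniformContinuous φ).continuous
  exact tendsto_stateSpace_iff.2 fun a =>
    hclosed.closure_subset_iff.2 hdom (hdense a)

-- States are equicontinuous, so pointwise convergence is uniform on the compact set `K`.
theorem tendsto_mkDist {K : Set (selfAdjoint A)} (hK : IsCompact K)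
    (hLK : ∀ a, L a ≤ 1 → ∃ r : ℝ, a - r • (1 : selfAdjoint A) ∈ K) (φ : stateSpace A) :
    Tendsto (fun ψ : stateSpace A => mkDist L φ ψ) (𝓝 φ) (𝓝 0) := by
  have hpointwise := tendsto_stateSpace_iff.1 (tendsto_id (x := 𝓝 φ))
  have huniform : TendstoUniformlyOn (fun (ψ : stateSpace A) (a : selfAdjoint A) => ψ.1 (a : A))
      (fun a => φ.1 (a : A)) (𝓝 φ) K := by
    have h := (EquicontinuousOn.tendsto_uniformOnFun_iff_pi' (𝔖 := {K}) (by simpa using hK)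
      (fun S _ => uniformEquicontinuous_stateSpace.equicontinuous.equicontinuousOn S) (𝓝 φ)
      (fun a => φ.1 (a : A))).2 (tendsto_pi_nhds.2 fun a => hpointwise a)
    exact UniformOnFun.tendsto_iff_tendstoUniformlyOn.1 h K rfl
  rw [EMetric.tendstoUniformlyOn_iff] at huniform
  refine ENNReal.tendsto_nhds_zero.2 fun ε hε => ?_
  filter_upwards [huniform ε hε] with ψ hψ
  refine iSup₂_le fun a ha => ?_
  obtain ⟨r, hr⟩ := hLK a ha
  have hshift (χ : stateSpace A) : χ.1 ((a - r • (1 : selfAdjoint A) : selfAdjoint A) : A) =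
      χ.1 (a : A) - r := by
    rw [AddSubgroupClass.coe_sub, selfAdjoint.val_smul, selfAdjoint.val_one, map_sub χ.1,
      ← Algebra.algebraMap_eq_smul_one, apply_algebraMap_real χ.2.1]
  have h := (hψ _ hr).le
  rwa [hshift, hshift, edist_sub_right, edist_eq_enorm_sub] at h

theorem hasBasis_nhds_mkDist
    (hsmul : ∀ (r : ℝ) (a : selfAdjoint A), L (r • a) = ‖r‖ₑ * L a)
    (hdense : Dense {a : selfAdjoint A | L a < ∞}) {K : Set (selfAdjoint A)} (hK : IsCompact K)
    (hLK : ∀ a, L a ≤ 1 → ∃ r : ℝ, a - r • (1 : selfAdjoint A) ∈ K) (φ : stateSpace A) :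
    (𝓝 φ).HasBasis (fun ε : ℝ≥0∞ => 0 < ε) fun ε => {ψ : stateSpace A | mkDist L φ ψ < ε} := by
  have hnhds : 𝓝 φ = (𝓝 0).comap fun ψ : stateSpace A => mkDist L φ ψ :=
    le_antisymm (tendsto_mkDist hK hLK φ).le_comap
      (tendsto_of_tendsto_mkDist hsmul hdense tendsto_comap)
  rw [hnhds]
  exact ENNReal.nhds_zero_basis.comap _

end Metrization

/-! ### Lipschitz functions -/

section LipschitzFunctions

open scoped NNReal

variable {X : Type*} [MetricSpace X]

theorem isCompact_setOf_norm_le_lipschitzWith {E : Type*} [NormedAddCommGroup E]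
    [ProperSpace E] (R : ℝ) (K : ℝ≥0) :
    IsCompact {f : C(X, E) | (∀ x, ‖f x‖ ≤ R) ∧ LipschitzWith K f} := by
  refine ArzelaAscoli.isCompact_of_equicontinuous _ ?_
    (LipschitzWith.uniformEquicontinuous _ K fun f => f.2.2).equicontinuous
  have himage : ContinuousMap.toFun '' {f : C(X, E) | (∀ x, ‖f x‖ ≤ R) ∧ LipschitzWith K f} =
      (Set.univ.pi fun _ => Metric.closedBall 0 R) ∩ {f | LipschitzWith K f} := by
    ext f
    simp only [Set.mem_image, Set.mem_ofPred_eq, Set.mem_inter_iff, Set.mem_univ_pi,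
      mem_closedBall_zero_iff]
    exact ⟨fun ⟨_, hg, hgf⟩ => hgf ▸ hg, fun hf => ⟨⟨f, hf.2.continuous⟩, hf, rfl⟩⟩
  rw [himage]
  exact (isCompact_univ_pi fun _ => isCompact_closedBall 0 R).inter_right
    (isClosed_setOfPred_lipschitzWith K)

/-- The algebra of real Lipschitz functions on a compact metric space, to which the
Stone-Weierstrass theorem applies. -/
def lipschitzSubalgebra (X : Type*) [MetricSpace X] [CompactSpace X] : Subalgebra ℝ C(X, ℝ) where
  carrier := {f | ∃ K, LipschitzWith K f}
  mul_mem' := by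
    rintro f g ⟨K, hf⟩ ⟨K', hg⟩
    refine ⟨‖f‖₊ * K' + ‖g‖₊ * K, LipschitzWith.of_dist_le_mul fun x y => ?_⟩
    calc dist ((f * g) x) ((f * g) y) = |f x * (g x - g y) + g y * (f x - f y)| := by
          rw [ContinuousMap.mul_apply, ContinuousMap.mul_apply, Real.dist_eq]
          ring_nf
      _ ≤ |f x| * dist (g x) (g y) + |g y| * dist (f x) (f y) := by
          rw [Real.dist_eq, Real.dist_eq, ← abs_mul, ← abs_mul]
          exact abs_add_le _ _
      _ ≤ ‖f‖ * (K' * dist x y) + ‖g‖ * (K * dist x y) := by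
          gcongr
          exacts [f.norm_coe_le_norm x, hg.dist_le_mul x y, g.norm_coe_le_norm y,
            hf.dist_le_mul x y]
      _ = ↑(‖f‖₊ * K' + ‖g‖₊ * K) * dist x y := by
          push_cast
          ring
  add_mem' := by
    rintro f g ⟨K, hf⟩ ⟨K', hg⟩
    exact ⟨K + K', hf.add hg⟩
  algebraMap_mem' r := ⟨0, LipschitzWith.const _⟩

theorem lipschitzSubalgebra_separatesPoints [CompactSpace X] :
    (lipschitzSubalgebra X).SeparatesPoints := fun x y hxy =>
  ⟨_, ⟨⟨fun z => dist z y, by fun_prop⟩, ⟨1, LipschitzWith.dist_left y⟩, rfl⟩, by simpa using hxy⟩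

theorem dense_setOf_lipschitzWith [CompactSpace X] (ι : Type*) [Fintype ι] :
    Dense {f : C(X, ι → ℝ) | ∃ K, LipschitzWith K f} := by
  refine Metric.dense_iff.2 fun f ε hε => ?_
  have hcoord (i : ι) : ∃ (g : C(X, ℝ)) (K : ℝ≥0), LipschitzWith K g ∧
      ∀ x, dist (g x) (f x i) < ε := by
    let fi : C(X, ℝ) := ⟨fun x => f x i, by fun_prop⟩
    obtain ⟨⟨g, K, hg⟩, hgf⟩ :=
      ContinuousMap.exists_mem_subalgebra_near_continuousMap_of_separatesPoints
        (lipschitzSubalgebra X) lipschitzSubalgebra_separatesPoints fi ε hε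
    rw [← dist_eq_norm] at hgf
    exact ⟨g, K, hg, (ContinuousMap.dist_lt_iff hε).1 hgf⟩
  choose g K hK hgf using hcoord
  exact ⟨ContinuousMap.pi g,
    (ContinuousMap.dist_lt_iff hε).2 fun x => (dist_pi_lt_iff hε).2 fun i => hgf i x,
    Finset.univ.sup K, fun x y => edist_pi_le_iff.2 fun i =>
      (hK i).weaken (Finset.le_sup (Finset.mem_univ i)) x y⟩

variable {Z : Type*} [PseudoMetricSpace Z] [CompactSpace X] [Nonempty X]

theorem exists_lipschitzWith_extension_real {Φ : X → Z} (hΦ : Isometry Φ) {f : X → ℝ} {K : ℝ≥0}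
    (hf : LipschitzWith K f) :
    ∃ g : Z → ℝ, LipschitzWith K g ∧ g ∘ Φ = f ∧ Set.range g ⊆ convexHull ℝ (Set.range f) := by
  have hext : LipschitzOnWith K (Function.extend Φ f 0) (Set.range Φ) := by
    rintro _ ⟨x, rfl⟩ _ ⟨y, rfl⟩
    rw [hΦ.injective.extend_apply, hΦ.injective.extend_apply, hΦ.edist_eq]
    exact hf x y
  obtain ⟨h, hh, hhf⟩ := hext.extend_real
  obtain ⟨x₀, h₀⟩ := hf.continuous.exists_forall_le (by simp)
  obtain ⟨x₁, h₁⟩ := hf.continuous.exists_forall_ge (by simp)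
  refine ⟨fun z => Set.projIcc (f x₀) (f x₁) (h₀ x₁) (h z), ?_, funext fun x => ?_, ?_⟩
  · exact ((LipschitzWith.subtype_val _).comp ((LipschitzWith.projIcc (h₀ x₁)).comp hh)).weaken
      (by simp)
  · have hx : h (Φ x) = f x := (hhf ⟨x, rfl⟩).symm.trans (hΦ.injective.extend_apply _ _ _)
    simp only [Function.comp_apply, hx, Set.projIcc_of_mem (h₀ x₁) ⟨h₀ x, h₁ x⟩]
  · rintro _ ⟨z, rfl⟩
    exact segment_subset_convexHull (Set.mem_range_self x₀) (Set.mem_range_self x₁)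
      ((segment_eq_Icc (h₀ x₁)).ge (Subtype.coe_prop _))

theorem exists_lipschitzWith_extension_pi {ι : Type*} [Fintype ι] {Φ : X → Z} (hΦ : Isometry Φ)
    {f : X → ι → ℝ} {K : ℝ≥0} (hf : LipschitzWith K f) :
    ∃ g : Z → ι → ℝ, LipschitzWith K g ∧ g ∘ Φ = f ∧
      ∀ c R, (∀ x, dist (f x) c ≤ R) → ∀ z, dist (g z) c ≤ R := by
  have hcoord (i : ι) := exists_lipschitzWith_extension_real hΦ
    (f := fun x => f x i) (K := K) fun x y => (edist_le_pi_edist _ _ i).trans (hf x y)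
  choose g hg hgf hrange using hcoord
  refine ⟨fun z i => g i z, fun y z => edist_pi_le_iff.2 fun i => hg i y z,
    funext fun x => funext fun i => congrFun (hgf i) x, fun c R hR z => ?_⟩
  obtain ⟨x₀⟩ := ‹Nonempty X›
  refine (dist_pi_le_iff (dist_nonneg.trans (hR x₀))).2 fun i => ?_
  have hball : Set.range (fun x => f x i) ⊆ Metric.closedBall (c i) R := by
    rintro _ ⟨x, rfl⟩
    exact (dist_le_pi_dist _ _ i).trans (hR x)
  exact convexHull_min hball (convex_closedBall _ _) (hrange i ⟨z, rfl⟩)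

end LipschitzFunctions

/-! ### Lipschitz seminorms modulo a line -/

section LipSeminorm

theorem enorm_comp_le {X Y E F : Type*} [TopologicalSpace X] [CompactSpace X]
    [TopologicalSpace Y] [CompactSpace Y] [SeminormedAddCommGroup E] [SeminormedAddCommGroup F]
    (T : C(E, F)) (hT : ∀ v, ‖T v‖ ≤ ‖v‖) (h : C(Y, X)) (f : C(X, E)) :
    ‖T.comp (f.comp h)‖ₑ ≤ ‖f‖ₑ := by
  rw [enorm_le_iff_norm_le]
  exact (ContinuousMap.norm_le _ (norm_nonneg f)).2 fun y => (hT _).trans (f.norm_coe_le_norm _)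

section Quotient

variable {V : Type*} [SeminormedAddCommGroup V] [NormedSpace ℝ V]

theorem enorm_mkQ_span_singleton (v f : V) :
    ‖(ℝ ∙ v).mkQ f‖ₑ = ⨅ r : ℝ, ‖f - r • v‖ₑ := by
  have hnorm : ‖(ℝ ∙ v).mkQ f‖ = Metric.infDist f (ℝ ∙ v : Submodule ℝ V) :=
    QuotientAddGroup.norm_mk (S := (ℝ ∙ v).toAddSubgroup) f
  have hne : ((ℝ ∙ v : Submodule ℝ V) : Set V).Nonempty := ⟨0, zero_mem _⟩
  rw [← ofReal_norm, hnorm, Metric.infDist, ENNReal.ofReal_toReal (Metric.infEDist_ne_top hne),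
    Submodule.span_singleton_eq_range, Metric.infEDist, iInf_range]
  simp only [edist_eq_enorm_sub]

end Quotient

section LipConst

open scoped NNReal

variable {X E : Type*} [MetricSpace X]

/-- The least Lipschitz constant of `f`, equal to `∞` if `f` is not Lipschitz. -/
noncomputable def lipConst [PseudoEMetricSpace E] (f : X → E) : ℝ≥0∞ :=
  ⨆ (x : X) (y : X) (_ : x ≠ y), edist (f x) (f y) / edist x y

theorem lipConst_le_iff [PseudoEMetricSpace E] {f : X → E} {c : ℝ≥0∞} :
    lipConst f ≤ c ↔ ∀ x y, edist (f x) (f y) ≤ c * edist x y := by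
  simp only [lipConst, iSup_le_iff]
  refine forall₂_congr fun x y => ?_
  rcases eq_or_ne x y with rfl | hxy
  · simp
  · simp only [ne_eq, hxy, not_false_eq_true, true_imp_iff,
      ENNReal.div_le_iff (edist_pos.2 hxy).ne' (edist_ne_top x y)]

theorem lipConst_le_coe_iff [PseudoEMetricSpace E] {f : X → E} {K : ℝ≥0} :
    lipConst f ≤ K ↔ LipschitzWith K f :=
  lipConst_le_iff

theorem edist_le_lipConst_mul [PseudoEMetricSpace E] (f : X → E) (x y : X) :
    edist (f x) (f y) ≤ lipConst f * edist x y :=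
  lipConst_le_iff.1 le_rfl x y

theorem lipConst_comp_le {Y F : Type*} [MetricSpace Y] [PseudoEMetricSpace E]
    [PseudoEMetricSpace F] {T : E → F} (hT : LipschitzWith 1 T) {h : Y → X}
    (hh : LipschitzWith 1 h) (f : X → E) : lipConst (T ∘ f ∘ h) ≤ lipConst f :=
  lipConst_le_iff.2 fun x y =>
    calc
      edist (T (f (h x))) (T (f (h y))) ≤ edist (f (h x)) (f (h y)) := by
        simpa using hT (f (h x)) (f (h y))
      _ ≤ lipConst f * edist (h x) (h y) := edist_le_lipConst_mul f _ _
      _ ≤ lipConst f * edist x y := by gcongr; simpa using hh x y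

variable [SeminormedAddCommGroup E]

theorem lipConst_add_le (f g : X → E) : lipConst (f + g) ≤ lipConst f + lipConst g :=
  lipConst_le_iff.2 fun x y => by
    rw [add_mul]
    exact (edist_add_add_le _ _ _ _).trans
      (add_le_add (edist_le_lipConst_mul f x y) (edist_le_lipConst_mul g x y))

theorem lipConst_smul [NormedSpace ℝ E] (r : ℝ) (f : X → E) :
    lipConst (r • f) = ‖r‖ₑ * lipConst f := by
  simp only [lipConst, Pi.smul_apply, edist_smul₀, ENNReal.smul_def, smul_eq_mul, mul_div_assoc,
    ENNReal.mul_iSup, enorm_eq_nnnorm]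

theorem lowerSemicontinuous_lipConst :
    LowerSemicontinuous fun f : C(X, E) => lipConst f := by
  refine lowerSemicontinuous_iSup fun x => lowerSemicontinuous_iSup fun y =>
    lowerSemicontinuous_iSup fun hxy => Continuous.lowerSemicontinuous ?_
  exact (ENNReal.continuous_div_const _ (edist_pos.2 hxy).ne').comp (by fun_prop)

end LipConst

variable {X E : Type*} [MetricSpace X] [CompactSpace X] [SeminormedAddCommGroup E]
  [NormedSpace ℝ E]

/-- The seminorm `max {Lip(f), inf_{r ∈ ℝ} ‖f - re‖}` of a function with values in a normed space
with a distinguished vector `e`. -/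
noncomputable def lipSeminorm (e : E) (f : C(X, E)) : ℝ≥0∞ :=
  max (lipConst f) ‖(ℝ ∙ ContinuousMap.const X e).mkQ f‖ₑ

theorem lipSeminorm_add_le (e : E) (f g : C(X, E)) :
    lipSeminorm e (f + g) ≤ lipSeminorm e f + lipSeminorm e g := by
  refine max_le ((lipConst_add_le f g).trans (add_le_add (le_max_left _ _) (le_max_left _ _))) ?_
  calc ‖(ℝ ∙ ContinuousMap.const X e).mkQ (f + g)‖ₑ
      ≤ ‖(ℝ ∙ ContinuousMap.const X e).mkQ f‖ₑ + ‖(ℝ ∙ ContinuousMap.const X e).mkQ g‖ₑ := by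
        rw [map_add]
        exact ENNReal.coe_le_coe.2 (nnnorm_add_le _ _)
    _ ≤ lipSeminorm e f + lipSeminorm e g := add_le_add (le_max_right _ _) (le_max_right _ _)

theorem lipSeminorm_smul (e : E) (r : ℝ) (f : C(X, E)) :
    lipSeminorm e (r • f) = ‖r‖ₑ * lipSeminorm e f := by
  rw [lipSeminorm, lipSeminorm, ContinuousMap.coe_smul, lipConst_smul, map_smul, enorm_smul,
    mul_max]

theorem lipSeminorm_const_self (e : E) : lipSeminorm e (ContinuousMap.const X e) = 0 := by
  refine nonpos_iff_eq_zero.1 (max_le (lipConst_le_iff.2 fun x y => by simp) ?_)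
  rw [enorm_mkQ_span_singleton]
  exact iInf_le_of_le 1 (by simp [← ofReal_norm])

theorem lowerSemicontinuous_lipSeminorm (e : E) :
    LowerSemicontinuous (lipSeminorm e : C(X, E) → ℝ≥0∞) := by
  have hquot : Continuous fun f : C(X, E) => ‖(ℝ ∙ ContinuousMap.const X e).mkQ f‖ₑ :=
    (ℝ ∙ ContinuousMap.const X e).mkQL.continuous.enorm
  exact lowerSemicontinuous_lipConst.sup hquot.lowerSemicontinuous

theorem lipSeminorm_comp_le {Y F : Type*} [MetricSpace Y] [CompactSpace Y]
    [SeminormedAddCommGroup F] [NormedSpace ℝ F] {T : E →L[ℝ] F} (hT : ∀ v, ‖T v‖ ≤ ‖v‖)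
    {h : C(Y, X)} (hh : LipschitzWith 1 h) (e : E) (f : C(X, E)) :
    lipSeminorm (T e) ((T : C(E, F)).comp (f.comp h)) ≤ lipSeminorm e f := by
  have hT' : LipschitzWith 1 T := LipschitzWith.of_dist_le_mul fun v w => by
    simpa [dist_eq_norm] using hT (v - w)
  refine max_le_max (lipConst_comp_le hT' hh f) ?_
  rw [enorm_mkQ_span_singleton, enorm_mkQ_span_singleton]
  refine iInf_mono fun r => ?_
  have hcomp : (T : C(E, F)).comp (f.comp h) - r • ContinuousMap.const Y (T e) =
      (T : C(E, F)).comp ((f - r • ContinuousMap.const X e).comp h) := by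
    ext y
    simp
  rw [hcomp]
  exact enorm_comp_le _ hT _ _

section Pi

variable {ι : Type*} [Fintype ι]

theorem abs_sub_projIcc_mul_le {e R t : ℝ} (he : e = 0 ∨ e = 1) (ht : |t| ≤ R) (h : -R ≤ R)
    (r : ℝ) : |t - Set.projIcc (-R) R h r * e| ≤ |t - r * e| := by
  rcases he with rfl | rfl
  · simp
  · have hproj : (Set.projIcc (-R) R h t : ℝ) = t := by
      rw [Set.projIcc_of_mem h (abs_le.1 ht)]
    rw [mul_one, mul_one]
    nth_rw 1 [← hproj]
    exact Set.abs_projIcc_sub_projIcc h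

theorem norm_sub_projIcc_smul_const_le {e : ι → ℝ} (he : ∀ i, e i = 0 ∨ e i = 1)
    (f : C(X, ι → ℝ)) (h : -‖f‖ ≤ ‖f‖) (r : ℝ) :
    ‖f - (Set.projIcc (-‖f‖) ‖f‖ h r : ℝ) • ContinuousMap.const X e‖ ≤
      ‖f - r • ContinuousMap.const X e‖ := by
  refine (ContinuousMap.norm_le _ (norm_nonneg _)).2 fun x =>
    (pi_norm_le_iff_of_nonneg (norm_nonneg _)).2 fun i => ?_
  have hfx : |f x i| ≤ ‖f‖ := (norm_le_pi_norm (f x) i).trans (f.norm_coe_le_norm x)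
  exact (abs_sub_projIcc_mul_le (he i) hfx h r).trans
    ((norm_le_pi_norm ((f - r • ContinuousMap.const X e) x) i).trans
      (ContinuousMap.norm_coe_le_norm _ x))

-- Replacing `r` by its projection to `[-‖f‖, ‖f‖]` only decreases the distance from `f` to `re`.
theorem exists_abs_le_norm_enorm_sub_smul_eq {e : ι → ℝ} (he : ∀ i, e i = 0 ∨ e i = 1)
    (f : C(X, ι → ℝ)) :
    ∃ r : ℝ, |r| ≤ ‖f‖ ∧ ‖f - r • ContinuousMap.const X e‖ₑ =
      ‖(ℝ ∙ ContinuousMap.const X e).mkQ f‖ₑ := by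
  have h : -‖f‖ ≤ ‖f‖ := neg_le_self (norm_nonneg f)
  obtain ⟨r, hr, hmin⟩ := (isCompact_Icc (a := -‖f‖) (b := ‖f‖)).exists_isMinOn
    (Set.nonempty_Icc.2 h) (f := fun r => ‖f - r • ContinuousMap.const X e‖)
    (by fun_prop)
  refine ⟨r, abs_le.2 hr, ?_⟩
  rw [enorm_mkQ_span_singleton]
  refine le_antisymm (le_iInf fun s => enorm_le_iff_norm_le.2 ?_) (iInf_le _ r)
  exact (hmin (Set.projIcc (-‖f‖) ‖f‖ h s).2).trans (norm_sub_projIcc_smul_const_le he f h s)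

end Pi
end LipSeminorm

/-! ### Real coordinates on a finite-dimensional C*-algebra -/

section MatrixNorm

variable {𝕜 m n : Type*} [RCLike 𝕜] [Fintype m] [Fintype n] [DecidableEq n]

theorem norm_entry_le_l2_opNorm (M : Matrix m n 𝕜) (i : m) (j : n) : ‖M i j‖ ≤ ‖M‖ := by
  have hcol := Matrix.l2_opNorm_mulVec M (EuclideanSpace.single j 1)
  rw [PiLp.norm_single, norm_one, mul_one] at hcol
  simpa using (PiLp.norm_apply_le _ i).trans hcol

theorem l2_opNorm_le_of_norm_entry_le {M : Matrix m n 𝕜} {c : ℝ} (hc : 0 ≤ c)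
    (h : ∀ i j, ‖M i j‖ ≤ c) : ‖M‖ ≤ √(Fintype.card m * Fintype.card n) * c := by
  rw [Matrix.l2_opNorm_def]
  refine ContinuousLinearMap.opNorm_le_bound _ (by positivity) fun x => ?_
  have hentry (i : m) : ‖∑ j, M i j * x j‖ ^ 2 ≤ c ^ 2 * (Fintype.card n * ‖x‖ ^ 2) :=
    calc ‖∑ j, M i j * x j‖ ^ 2 ≤ (c * ∑ j, ‖x j‖) ^ 2 := by
          gcongr
          rw [Finset.mul_sum]
          exact norm_sum_le_of_le _ fun j _ => (norm_mul _ _).trans_le (by gcongr; exact h i j)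
      _ ≤ c ^ 2 * (Fintype.card n * ‖x‖ ^ 2) := by
          rw [mul_pow, EuclideanSpace.norm_sq_eq]
          gcongr
          exact sq_sum_le_card_mul_sum_sq
  rw [EuclideanSpace.norm_eq]
  refine Real.sqrt_le_left (by positivity) |>.2 ?_
  calc ∑ i, ‖∑ j, M i j * x j‖ ^ 2 ≤ ∑ _i : m, c ^ 2 * (Fintype.card n * ‖x‖ ^ 2) :=
        Finset.sum_le_sum fun i _ => hentry i
    _ = (√(Fintype.card m * Fintype.card n) * c * ‖x‖) ^ 2 := by
        rw [mul_pow, mul_pow, Real.sq_sqrt (by positivity), Finset.sum_const, nsmul_eq_mul,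
          Finset.card_univ]
        ring

end MatrixNorm

section RealCoords

variable {n : ℕ} {m : Fin (n + 1) → ℕ}

/-- The real coordinates of `FDAlg m`: the left summand indexes the real parts of the matrix
entries, the right summand their imaginary parts. -/
abbrev RealEntry (m : Fin (n + 1) → ℕ) : Type :=
  (Σ l, Fin (m l) × Fin (m l)) ⊕ (Σ l, Fin (m l) × Fin (m l))

/-- The real and imaginary parts of all matrix entries. The sup norm of the coordinates is
`realMaxNorm`. -/
noncomputable def realCoords : FDAlg m ≃L[ℝ] (RealEntry m → ℝ) :=
  LinearEquiv.toContinuousLinearEquiv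
    { toFun v := Sum.elim (fun p => (v p.1 p.2.1 p.2.2).re) fun p => (v p.1 p.2.1 p.2.2).im
      invFun c l := Matrix.of fun j k => ⟨c (.inl ⟨l, j, k⟩), c (.inr ⟨l, j, k⟩)⟩
      map_add' v w := by ext (p | p) <;> simp
      map_smul' r v := by ext (p | p) <;> simp
      left_inv v := by ext l j k; simp
      right_inv c := by ext (p | p) <;> simp }

theorem realCoords_inl (v : FDAlg m) (l : Fin (n + 1)) (j k : Fin (m l)) :
    realCoords v (.inl ⟨l, j, k⟩) = (v l j k).re :=
  rfl

theorem realCoords_inr (v : FDAlg m) (l : Fin (n + 1)) (j k : Fin (m l)) :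
    realCoords v (.inr ⟨l, j, k⟩) = (v l j k).im :=
  rfl

theorem norm_realCoords_le_iff {v : FDAlg m} {c : ℝ} (hc : 0 ≤ c) :
    ‖realCoords v‖ ≤ c ↔ ∀ l j k, max |(v l j k).re| |(v l j k).im| ≤ c := by
  simp only [pi_norm_le_iff_of_nonneg hc, Sum.forall, Sigma.forall, Prod.forall, realCoords_inl,
    realCoords_inr, Real.norm_eq_abs, max_le_iff, forall_and]

theorem realMaxNorm_eq_enorm_realCoords (v : FDAlg m) : realMaxNorm v = ‖realCoords v‖ₑ := by
  refine eq_of_forall_ge_iff fun c => ?_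
  rw [← edist_zero_right, edist_pi_le_iff]
  simp only [realMaxNorm, iSup_le_iff, ENNReal.ofReal_max, max_le_iff, forall_and,
    Pi.zero_apply, edist_zero_right, Real.enorm_eq_ofReal_abs, Sum.forall, Sigma.forall,
    Prod.forall, realCoords_inl, realCoords_inr]

theorem norm_realCoords_le (v : FDAlg m) : ‖realCoords v‖ ≤ ‖v‖ := by
  refine (norm_realCoords_le_iff (norm_nonneg _)).2 fun l j k => ?_
  have hentry : ‖v l j k‖ ≤ ‖v‖ := (norm_entry_le_l2_opNorm _ _ _).trans (norm_le_pi_norm v l)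
  exact max_le ((Complex.abs_re_le_norm _).trans hentry) ((Complex.abs_im_le_norm _).trans hentry)

theorem norm_le_mul_norm_realCoords (v : FDAlg m) :
    ‖v‖ ≤ √2 * maxSize m * ‖realCoords v‖ := by
  refine (pi_norm_le_iff_of_nonneg (by positivity)).2 fun l => ?_
  have hentry (j k : Fin (m l)) : ‖v l j k‖ ≤ √2 * ‖realCoords v‖ :=
    (Complex.norm_le_sqrt_two_mul_max _).trans <| by
      gcongr
      exact (norm_realCoords_le_iff (norm_nonneg _)).1 le_rfl l j k
  have hsize : (m l : ℝ) ≤ maxSize m := by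
    exact_mod_cast Finset.le_sup (f := m) (Finset.mem_univ l)
  calc ‖v l‖ ≤ m l * (√2 * ‖realCoords v‖) := by
        simpa using l2_opNorm_le_of_norm_entry_le (by positivity) hentry
    _ ≤ maxSize m * (√2 * ‖realCoords v‖) := by gcongr
    _ = √2 * maxSize m * ‖realCoords v‖ := by ring

theorem one_le_sqrt_two_mul_maxSize [Nontrivial (FDAlg m)] : 1 ≤ √2 * maxSize m :=
  calc (1 : ℝ) = ‖(1 : FDAlg m)‖ := CStarRing.norm_one.symm
    _ ≤ √2 * maxSize m * ‖realCoords (1 : FDAlg m)‖ := norm_le_mul_norm_realCoords 1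
    _ ≤ √2 * maxSize m := mul_le_of_le_one_right (by positivity)
        ((norm_realCoords_le 1).trans_eq CStarRing.norm_one)

theorem realCoords_one_eq_zero_or_one (i : RealEntry m) :
    realCoords (1 : FDAlg m) i = 0 ∨ realCoords (1 : FDAlg m) i = 1 := by
  rcases i with ⟨l, j, k⟩ | ⟨l, j, k⟩
  · rw [realCoords_inl, Pi.one_apply, Matrix.one_apply]
    split_ifs <;> simp
  · rw [realCoords_inr, Pi.one_apply, Matrix.one_apply]
    split_ifs <;> simp

theorem norm_realCoords_star_le (v : FDAlg m) : ‖realCoords (star v)‖ ≤ ‖realCoords v‖ := by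
  refine (norm_realCoords_le_iff (norm_nonneg _)).2 fun l j k => ?_
  simpa [Matrix.star_apply] using (norm_realCoords_le_iff (norm_nonneg _)).1 le_rfl l k j

/-- The self-adjoint part of the element of `FDAlg m` with given real coordinates, a left inverse
of the restriction of `realCoords` to the self-adjoint elements. -/
noncomputable def ofRealCoords : (RealEntry m → ℝ) →L[ℝ] selfAdjoint (FDAlg m) :=
  (selfAdjointPartL ℝ (FDAlg m)).comp realCoords.symm.toContinuousLinearMap

theorem ofRealCoords_realCoords {v : FDAlg m} (hv : IsSelfAdjoint v) :
    (ofRealCoords (realCoords v) : FDAlg m) = v := by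
  change (selfAdjointPart ℝ (realCoords.symm (realCoords v)) : FDAlg m) = v
  rw [ContinuousLinearEquiv.symm_apply_apply, hv.coe_selfAdjointPart_apply ℝ]

theorem norm_realCoords_ofRealCoords_le (c : RealEntry m → ℝ) :
    ‖realCoords (ofRealCoords c : FDAlg m)‖ ≤ ‖c‖ := by
  obtain ⟨v, rfl⟩ := realCoords.surjective c
  have hpart : (ofRealCoords (realCoords v) : FDAlg m) = (⅟2 : ℝ) • (v + star v) := by
    change (selfAdjointPart ℝ (realCoords.symm (realCoords v)) : FDAlg m) = _
    rw [ContinuousLinearEquiv.symm_apply_apply, selfAdjointPart_apply_coe]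
  rw [hpart, map_smul, map_add, norm_smul]
  have := norm_add_le (realCoords v) (realCoords (star v))
  have := norm_realCoords_star_le v
  norm_num
  linarith

theorem norm_ofRealCoords_le (c : RealEntry m → ℝ) :
    ‖(ofRealCoords c : FDAlg m)‖ ≤ √2 * maxSize m * ‖c‖ :=
  (norm_le_mul_norm_realCoords _).trans (by gcongr; exact norm_realCoords_ofRealCoords_le c)

end RealCoords

/-! ### The Lip-norm of `C(X, 𝔄)` -/

section LipNorm

variable {n : ℕ} {m : Fin (n + 1) → ℕ} {X : Type u} [MetricSpace X]

/-- The self-adjoint element of `C(X, FDAlg m)` obtained by applying `ofRealCoords` pointwise. -/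
noncomputable def ofCoords (f : C(X, RealEntry m → ℝ)) : selfAdjoint C(X, FDAlg m) where
  val := ⟨fun x => ofRealCoords (f x), by fun_prop⟩
  property := ContinuousMap.ext fun x => (ofRealCoords (f x)).2

theorem ofCoords_apply (f : C(X, RealEntry m → ℝ)) (x : X) :
    (ofCoords f : C(X, FDAlg m)) x = ofRealCoords (f x) :=
  rfl

/-- The real coordinates of a matrix-valued function, taken pointwise. -/
noncomputable def coords : C(X, FDAlg m) →L[ℝ] C(X, RealEntry m → ℝ) :=
  (realCoords (m := m) : FDAlg m →L[ℝ] RealEntry m → ℝ).compLeftContinuous ℝ X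

theorem coords_apply (a : C(X, FDAlg m)) (x : X) : coords a x = realCoords (a x) :=
  rfl

theorem coords_injective :
    Function.Injective (coords : C(X, FDAlg m) → C(X, RealEntry m → ℝ)) := fun _ _ h =>
  ContinuousMap.ext fun x => realCoords.injective (DFunLike.congr_fun h x)

theorem coords_smul_one (r : ℝ) :
    coords (r • 1 : C(X, FDAlg m)) = r • ContinuousMap.const X (realCoords (1 : FDAlg m)) := by
  rw [map_smul]
  rfl

theorem ofCoords_coords (a : selfAdjoint C(X, FDAlg m)) : ofCoords (coords a.1) = a :=
  Subtype.ext <| ContinuousMap.ext fun x =>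
    ofRealCoords_realCoords (congrArg (fun f : C(X, FDAlg m) => f x) a.2)

theorem continuous_ofCoords :
    Continuous (ofCoords : C(X, RealEntry m → ℝ) → selfAdjoint C(X, FDAlg m)) := by
  let T : C(RealEntry m → ℝ, FDAlg m) := ⟨fun c => ofRealCoords c, by fun_prop⟩
  exact (ContinuousMap.continuous_postcomp T).subtype_mk _

variable [CompactSpace X]

theorem lipNorm_eq_lipSeminorm_coords (a : selfAdjoint C(X, FDAlg m)) :
    lipNorm m X a = lipSeminorm (realCoords 1) (coords a.1) := by
  simp only [lipNorm, lipSeminorm, lipConst, enorm_mkQ_span_singleton,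
    ContinuousMap.enorm_eq_iSup_enorm, realMaxNorm_eq_enorm_realCoords, edist_eq_enorm_sub,
    map_sub, map_smul, coords_apply, ContinuousMap.sub_apply, ContinuousMap.smul_apply,
    ContinuousMap.const_apply]

theorem lipNorm_add_le (a b : selfAdjoint C(X, FDAlg m)) :
    lipNorm m X (a + b) ≤ lipNorm m X a + lipNorm m X b := by
  simp only [lipNorm_eq_lipSeminorm_coords, AddSubgroup.coe_add, map_add]
  exact lipSeminorm_add_le _ _ _

theorem lipNorm_smul (r : ℝ) (a : selfAdjoint C(X, FDAlg m)) :
    lipNorm m X (r • a) = ‖r‖ₑ * lipNorm m X a := by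
  simp only [lipNorm_eq_lipSeminorm_coords, selfAdjoint.val_smul, map_smul, lipSeminorm_smul]

theorem lowerSemicontinuous_lipNorm : LowerSemicontinuous (lipNorm m X) := by
  simp only [funext lipNorm_eq_lipSeminorm_coords]
  exact (lowerSemicontinuous_lipSeminorm _).comp (by fun_prop)

theorem lipNorm_ofCoords_le (f : C(X, RealEntry m → ℝ)) :
    lipNorm m X (ofCoords f) ≤ lipSeminorm (realCoords 1) f := by
  let T : (RealEntry m → ℝ) →L[ℝ] RealEntry m → ℝ :=
    realCoords.toContinuousLinearMap.comp
      ((selfAdjoint.submodule ℝ (FDAlg m)).subtypeL.comp ofRealCoords)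
  have hT : T (realCoords 1) = realCoords 1 :=
    congrArg realCoords (ofRealCoords_realCoords (IsSelfAdjoint.one _))
  have h := lipSeminorm_comp_le (T := T) norm_realCoords_ofRealCoords_le
    (h := ContinuousMap.id X) LipschitzWith.id (realCoords 1) f
  rw [hT] at h
  rw [lipNorm_eq_lipSeminorm_coords]
  exact h

theorem dense_lipNorm_lt_top : Dense {a : selfAdjoint C(X, FDAlg m) | lipNorm m X a < ∞} := by
  have hsurj : Function.Surjective (ofCoords (m := m) (X := X)) := fun a =>
    ⟨_, ofCoords_coords a⟩
  refine (hsurj.denseRange.dense_image continuous_ofCoords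
    (dense_setOf_lipschitzWith (X := X) (RealEntry m))).mono ?_
  rintro _ ⟨f, ⟨K, hK⟩, rfl⟩
  exact (lipNorm_ofCoords_le f).trans_lt
    (max_lt ((lipConst_le_coe_iff.2 hK).trans_lt ENNReal.coe_lt_top) enorm_lt_top)

theorem exists_abs_le_norm_enorm_coords_sub_smul_one_le (a : selfAdjoint C(X, FDAlg m)) :
    ∃ r : ℝ, |r| ≤ ‖a‖ ∧ ‖coords (a.1 - r • 1)‖ₑ ≤ lipNorm m X a := by
  obtain ⟨r, hr, hdist⟩ :=
    exists_abs_le_norm_enorm_sub_smul_eq realCoords_one_eq_zero_or_one (coords a.1)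
  refine ⟨r, hr.trans ?_, ?_⟩
  · exact (ContinuousMap.norm_le _ (norm_nonneg _)).2 fun x =>
      (norm_realCoords_le _).trans (ContinuousMap.norm_coe_le_norm a.1 x)
  · rw [map_sub, coords_smul_one, hdist, lipNorm_eq_lipSeminorm_coords]
    exact le_max_right _ _

theorem lipNorm_smul_one (r : ℝ) : lipNorm m X (r • 1) = 0 := by
  have hone : lipNorm m X 1 = 0 :=
    (lipNorm_eq_lipSeminorm_coords 1).trans (lipSeminorm_const_self (realCoords 1))
  rw [lipNorm_smul, hone, mul_zero]

theorem lipNorm_sub_smul_one_le (a : selfAdjoint C(X, FDAlg m)) (r : ℝ) :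
    lipNorm m X (a - r • 1) ≤ lipNorm m X a := by
  have hneg : a - r • (1 : selfAdjoint C(X, FDAlg m)) = a + (-r) • 1 := by module
  rw [hneg]
  exact (lipNorm_add_le _ _).trans_eq (by rw [lipNorm_smul_one, add_zero])

theorem lipNorm_eq_zero_iff (a : selfAdjoint C(X, FDAlg m)) :
    lipNorm m X a = 0 ↔ ∃ r : ℝ, a = r • (1 : selfAdjoint C(X, FDAlg m)) := by
  refine ⟨fun ha => ?_, fun ⟨r, hr⟩ => hr ▸ lipNorm_smul_one r⟩
  obtain ⟨r, -, hr⟩ := exists_abs_le_norm_enorm_coords_sub_smul_one_le a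
  have hzero : coords (a.1 - r • 1) = 0 :=
    nnnorm_eq_zero.1 (ENNReal.coe_eq_zero.1 (nonpos_iff_eq_zero.1 (hr.trans_eq ha)))
  exact ⟨r, Subtype.ext (sub_eq_zero.1 ((map_eq_zero_iff _ coords_injective).1 hzero))⟩

theorem exists_isCompact_sub_smul_one_mem :
    ∃ K : Set (selfAdjoint C(X, FDAlg m)), IsCompact K ∧
      ∀ a, lipNorm m X a ≤ 1 → ∃ r : ℝ, a - r • (1 : selfAdjoint C(X, FDAlg m)) ∈ K := by
  refine ⟨_, (isCompact_setOf_norm_le_lipschitzWith (X := X) (E := RealEntry m → ℝ) 1 1).image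
    continuous_ofCoords, fun a ha => ?_⟩
  obtain ⟨r, -, hr⟩ := exists_abs_le_norm_enorm_coords_sub_smul_one_le a
  refine ⟨r, coords (a - r • (1 : selfAdjoint C(X, FDAlg m))).1, ⟨fun x => ?_, ?_⟩,
    ofCoords_coords _⟩
  · exact (ContinuousMap.norm_coe_le_norm _ x).trans
      ((enorm_le_iff_norm_le.1 ((hr.trans ha).trans_eq enorm_one.symm)).trans_eq
        (norm_one (α := ℝ)))
  · refine lipConst_le_coe_iff.1 (le_trans ?_ ((lipNorm_sub_smul_one_le a r).trans ha))
    rw [lipNorm_eq_lipSeminorm_coords]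
    exact le_max_left _ _

end LipNorm

/-! ### The quasi-Leibniz property -/

section Leibniz

theorem enorm_map_map_sub_map_map_le {V W U : Type*} [NormedAddCommGroup V] [NormedSpace ℝ V]
    [NormedAddCommGroup W] [NormedSpace ℝ W] [NormedAddCommGroup U] [NormedSpace ℝ U]
    {P : V →ₗ[ℝ] W →ₗ[ℝ] U} (hP : ∀ v w, ‖P v w‖ₑ ≤ ‖v‖ₑ * ‖w‖ₑ) (v v' : V) (w w' : W) :
    ‖P v w - P v' w'‖ₑ ≤ ‖v‖ₑ * ‖w - w'‖ₑ + ‖w'‖ₑ * ‖v - v'‖ₑ :=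
  calc ‖P v w - P v' w'‖ₑ = ‖P v (w - w') + P (v - v') w'‖ₑ := by
        simp only [map_sub, LinearMap.sub_apply, sub_add_sub_cancel]
    _ ≤ ‖P v (w - w')‖ₑ + ‖P (v - v') w'‖ₑ := enorm_add_le _ _
    _ ≤ ‖v‖ₑ * ‖w - w'‖ₑ + ‖w'‖ₑ * ‖v - v'‖ₑ := by
        rw [mul_comm ‖w'‖ₑ]
        exact add_le_add (hP _ _) (hP _ _)

variable {n : ℕ} {m : Fin (n + 1) → ℕ}

theorem enorm_realCoords_map_map_sub_map_map_le {P : FDAlg m →ₗ[ℝ] FDAlg m →ₗ[ℝ] FDAlg m}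
    (hP : ∀ u v, ‖P u v‖ₑ ≤ ‖u‖ₑ * ‖v‖ₑ) {u v u' v' : FDAlg m} {N M c d : ℝ≥0∞}
    (hu : ‖u‖ₑ ≤ N) (hv' : ‖v'‖ₑ ≤ M) (hv : ‖realCoords (v - v')‖ₑ ≤ c)
    (hu' : ‖realCoords (u - u')‖ₑ ≤ d) :
    ‖realCoords (P u v - P u' v')‖ₑ ≤ ENNReal.ofReal (√2 * maxSize m) * (N * c + M * d) := by
  have hcomp (z : FDAlg m) : ‖z‖ₑ ≤ ENNReal.ofReal (√2 * maxSize m) * ‖realCoords z‖ₑ := by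
    rw [← ofReal_norm, ← ofReal_norm, ← ENNReal.ofReal_mul (by positivity)]
    exact ENNReal.ofReal_le_ofReal (norm_le_mul_norm_realCoords z)
  calc ‖realCoords (P u v - P u' v')‖ₑ ≤ ‖P u v - P u' v'‖ₑ :=
        enorm_le_iff_norm_le.2 (norm_realCoords_le _)
    _ ≤ ‖u‖ₑ * ‖v - v'‖ₑ + ‖v'‖ₑ * ‖u - u'‖ₑ := enorm_map_map_sub_map_map_le hP _ _ _ _
    _ ≤ N * (ENNReal.ofReal (√2 * maxSize m) * c) +
          M * (ENNReal.ofReal (√2 * maxSize m) * d) := by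
        gcongr
        · exact (hcomp _).trans (by gcongr)
        · exact (hcomp _).trans (by gcongr)
    _ = ENNReal.ofReal (√2 * maxSize m) * (N * c + M * d) := by ring

variable {X : Type u} [MetricSpace X] [CompactSpace X]

theorem enorm_apply_le_enorm {E : Type*} [SeminormedAddCommGroup E] (a : C(X, E)) (x : X) :
    ‖a x‖ₑ ≤ ‖a‖ₑ :=
  enorm_le_iff_norm_le.2 (a.norm_coe_le_norm x)

theorem enorm_realCoords_apply_sub_apply_le (a : selfAdjoint C(X, FDAlg m)) (x y : X) :
    ‖realCoords (a.1 x - a.1 y)‖ₑ ≤ lipNorm m X a * edist x y := by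
  rw [map_sub, ← coords_apply, ← coords_apply, ← edist_eq_enorm_sub,
    lipNorm_eq_lipSeminorm_coords]
  exact lipConst_le_iff.1 (le_max_left _ _) x y

theorem enorm_realCoords_apply_sub_smul_one_le {a : C(X, FDAlg m)} {r : ℝ} {c : ℝ≥0∞}
    (h : ‖coords (a - r • 1)‖ₑ ≤ c) (x : X) : ‖realCoords (a x - r • 1)‖ₑ ≤ c := by
  have hx : coords (a - r • 1) x = realCoords (a x - r • 1) := rfl
  rw [← hx]
  exact (enorm_apply_le_enorm _ x).trans h

theorem lipNorm_le_of_apply_eq [Nontrivial (FDAlg m)] {P : FDAlg m →ₗ[ℝ] FDAlg m →ₗ[ℝ] FDAlg m}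
    (hP : ∀ u v, ‖P u v‖ₑ ≤ ‖u‖ₑ * ‖v‖ₑ) {t : ℝ} (hone : P 1 1 = t • 1)
    {a b p : selfAdjoint C(X, FDAlg m)} (hp : ∀ x, p.1 x = P (a.1 x) (b.1 x)) :
    lipNorm m X p ≤ ENNReal.ofReal (√2 * maxSize m) *
      (‖a.1‖ₑ * lipNorm m X b + ‖b.1‖ₑ * lipNorm m X a) := by
  rw [lipNorm_eq_lipSeminorm_coords p]
  refine max_le (lipConst_le_iff.2 fun x y => ?_) ?_
  · rw [edist_eq_enorm_sub, coords_apply, coords_apply, ← map_sub, hp, hp, mul_assoc, add_mul,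
      mul_assoc, mul_assoc]
    exact enorm_realCoords_map_map_sub_map_map_le hP (enorm_apply_le_enorm _ _)
      (enorm_apply_le_enorm _ _) (enorm_realCoords_apply_sub_apply_le b x y)
      (enorm_realCoords_apply_sub_apply_le a x y)
  · obtain ⟨r, -, har⟩ := exists_abs_le_norm_enorm_coords_sub_smul_one_le a
    obtain ⟨s, hs, hbs⟩ := exists_abs_le_norm_enorm_coords_sub_smul_one_le b
    have hscalar : P (r • 1) (s • 1) = (r * s * t) • 1 := by
      rw [map_smul, map_smul, LinearMap.smul_apply, hone]
      module
    have hsone : ‖s • (1 : FDAlg m)‖ₑ ≤ ‖b.1‖ₑ := by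
      rw [enorm_le_iff_norm_le, norm_smul, CStarRing.norm_one, mul_one]
      exact hs
    rw [enorm_mkQ_span_singleton]
    refine iInf_le_of_le (r * s * t) ?_
    rw [← coords_smul_one, ← map_sub, ContinuousMap.enorm_eq_iSup_enorm]
    refine iSup_le fun x => ?_
    have hpx : (p.1 - (r * s * t) • 1) x = P (a.1 x) (b.1 x) - P (r • 1) (s • 1) := by
      rw [hscalar, ← hp]
      rfl
    rw [coords_apply, hpx]
    exact enorm_realCoords_map_map_sub_map_map_le hP (enorm_apply_le_enorm _ _) hsone
      (enorm_realCoords_apply_sub_smul_one_le hbs x)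
      (enorm_realCoords_apply_sub_smul_one_le har x)

section HalfSum

variable {A : Type*} [NormedRing A] [NormedAlgebra ℂ A]

/-- The bilinear map `(u, v) ↦ c (uv + ε vu)`. The Jordan product has `c = 1 / 2` and `ε = 1`, the
Lie product `c = 1 / (2i)` and `ε = -1`. -/
noncomputable def twistedMul (c ε : ℂ) : A →ₗ[ℝ] A →ₗ[ℝ] A :=
  c • (LinearMap.mul ℝ A + ε • (LinearMap.mul ℝ A).flip)

theorem twistedMul_apply (c ε : ℂ) (u v : A) : twistedMul c ε u v = c • (u * v + ε • (v * u)) :=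
  rfl

theorem enorm_twistedMul_le {c ε : ℂ} (hc : ‖c‖ = 1 / 2) (hε : ‖ε‖ = 1) (u v : A) :
    ‖twistedMul c ε u v‖ₑ ≤ ‖u‖ₑ * ‖v‖ₑ := by
  have hnorm : ‖twistedMul c ε u v‖₊ ≤ ‖u‖₊ * ‖v‖₊ := by
    have hsum : ‖u * v + ε • (v * u)‖ ≤ ‖u‖ * ‖v‖ + ‖v‖ * ‖u‖ :=
      norm_add_le_of_le (norm_mul_le u v) (by simpa [norm_smul, hε] using norm_mul_le v u)
    change ‖c • (u * v + ε • (v * u))‖ ≤ ‖u‖ * ‖v‖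
    rw [norm_smul, hc]
    linarith
  exact (ENNReal.coe_le_coe.2 hnorm).trans_eq (ENNReal.coe_mul _ _)

end HalfSum

theorem lipNorm_jordanMul_le [Nontrivial (FDAlg m)] (a b : selfAdjoint C(X, FDAlg m)) :
    lipNorm m X (jordanMul a b) ≤ ENNReal.ofReal (√2 * maxSize m) *
      (‖a.1‖ₑ * lipNorm m X b + ‖b.1‖ₑ * lipNorm m X a) := by
  refine lipNorm_le_of_apply_eq (P := twistedMul (1 / 2) 1)
    (enorm_twistedMul_le (by simp) norm_one) (t := 1) ?_ fun x => ?_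
  · rw [twistedMul_apply, one_smul, mul_one, ← two_smul ℂ, smul_smul, one_smul]
    norm_num
  · rw [twistedMul_apply, one_smul]
    rfl

theorem lipNorm_lieMul_le [Nontrivial (FDAlg m)] (a b : selfAdjoint C(X, FDAlg m)) :
    lipNorm m X (lieMul a b) ≤ ENNReal.ofReal (√2 * maxSize m) *
      (‖a.1‖ₑ * lipNorm m X b + ‖b.1‖ₑ * lipNorm m X a) := by
  refine lipNorm_le_of_apply_eq (P := twistedMul (1 / (2 * Complex.I)) (-1))
    (enorm_twistedMul_le (by simp) (by simp)) (t := 0) ?_ fun x => ?_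
  · rw [twistedMul_apply, neg_one_smul, add_neg_cancel, smul_zero, zero_smul]
  · rw [twistedMul_apply, neg_one_smul, ← sub_eq_add_neg]
    rfl

theorem isQuasiLeibnizCQMS_lipNorm [Nontrivial (FDAlg m)] [Nonempty X] :
    IsQuasiLeibnizCQMS C(X, FDAlg m) (√2 * maxSize m) 0 (lipNorm m X) where
  isCompactQuantumMetric :=
    { nontrivial := inferInstance
      add_le := lipNorm_add_le
      smul := lipNorm_smul
      dense_dom := dense_lipNorm_lt_top
      eq_zero_iff := lipNorm_eq_zero_iff
      metrizes := by
        obtain ⟨K, hK, hLK⟩ := exists_isCompact_sub_smul_one_mem (m := m) (X := X)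
        exact hasBasis_nhds_mkDist lipNorm_smul dense_lipNorm_lt_top hK hLK
      lsc := lowerSemicontinuous_lipNorm }
  one_le := one_le_sqrt_two_mul_maxSize
  nonneg := le_rfl
  quasiLeibniz a b _ _ := by
    rw [ENNReal.ofReal_zero, zero_mul, zero_mul, add_zero]
    exact max_le (lipNorm_jordanMul_le a b) (lipNorm_lieMul_le a b)

/-- The quasi-Leibniz compact quantum metric space formed by `C(X, FDAlg m)` and `lipNorm m X`. -/
noncomputable abbrev lipSpace (m : Fin (n + 1) → ℕ) [Nontrivial (FDAlg m)] (X : Type u)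
    [MetricSpace X] [CompactSpace X] [Nonempty X] : QLCQMS.{u} :=
  QLCQMS.of (isQuasiLeibnizCQMS_lipNorm (m := m) (X := X))

end Leibniz

/-! ### Bridges with pivot `1` -/

section PivotOne

theorem hausdorffOf_le {α : Type u} {d : α → α → ℝ≥0∞} {s t : Set α} {c : ℝ≥0∞}
    (hs : ∀ x ∈ s, ∃ y ∈ t, d x y ≤ c) (ht : ∀ y ∈ t, ∃ x ∈ s, d x y ≤ c) :
    hausdorffOf d s t ≤ c := by
  refine max_le (iSup₂_le fun x hx => ?_) (iSup₂_le fun y hy => ?_)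
  · obtain ⟨y, hy, hxy⟩ := hs x hx
    exact iInf₂_le_of_le y hy hxy
  · obtain ⟨x, hx, hxy⟩ := ht y hy
    exact iInf₂_le_of_le x hx hxy

theorem hausdorffOf_self {α : Type u} {d : α → α → ℝ≥0∞} (hd : ∀ x, d x x = 0) (s : Set α) :
    hausdorffOf d s s = 0 :=
  nonpos_iff_eq_zero.1 <|
    hausdorffOf_le (fun x hx => ⟨x, hx, (hd x).le⟩) fun x hx => ⟨x, hx, (hd x).le⟩

variable {A B D : Type u} [CStarAlgebra A] [CStarAlgebra B] [CStarAlgebra D]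

theorem mkDist_self (L : selfAdjoint A → ℝ≥0∞) (φ : WeakDual ℂ A) : mkDist L φ φ = 0 := by
  simp [mkDist]

theorem levelSet_one : levelSet (1 : D) = stateSpace D := by
  ext φ
  simp [levelSet]

theorem setOf_comp_levelSet_one {ρ : A →⋆ₐ[ℂ] D} (hρ : Function.Injective ρ) :
    {ψ : WeakDual ℂ A | ∃ φ ∈ levelSet (1 : D), ∀ a, ψ a = φ (ρ a)} = stateSpace A := by
  rw [levelSet_one]
  ext ψ
  exact ⟨fun ⟨φ, hφ, h⟩ => mem_stateSpace_of_apply_eq ρ hφ h,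
    fun hψ => exists_mem_stateSpace_extension ρ hρ hψ⟩

variable [Nontrivial D] {ρ : A →⋆ₐ[ℂ] D} {σ : B →⋆ₐ[ℂ] D}

/-- The bridge with pivot `1` given by two unital *-monomorphisms; its height is zero, so that its
length is its reach. -/
def pivotOneBridge (hρ : Function.Injective ρ) (hσ : Function.Injective σ) : Bridge A B where
  D := D
  pivot := 1
  left := ρ
  right := σ
  left_injective := hρ
  right_injective := hσ
  levelSet_nonempty := by rw [levelSet_one]; exact stateSpace_nonempty

variable (hρ : Function.Injective ρ) (hσ : Function.Injective σ)
  {LA : selfAdjoint A → ℝ≥0∞} {LB : selfAdjoint B → ℝ≥0∞}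

theorem height_pivotOneBridge : (pivotOneBridge hρ hσ).height LA LB = 0 := by
  change max (hausdorffOf (mkDist LA) (stateSpace A)
      {ψ | ∃ φ ∈ levelSet (1 : D), ∀ a : A, ψ a = φ (ρ a)})
    (hausdorffOf (mkDist LB) (stateSpace B)
      {ψ | ∃ φ ∈ levelSet (1 : D), ∀ b : B, ψ b = φ (σ b)}) = 0
  rw [setOf_comp_levelSet_one hρ, setOf_comp_levelSet_one hσ, hausdorffOf_self (mkDist_self LA),
    hausdorffOf_self (mkDist_self LB), max_self]

theorem length_pivotOneBridge_le {c : ℝ≥0∞}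
    (hA : ∀ a, LA a ≤ 1 → ∃ b, LB b ≤ 1 ∧ edist (ρ (a : A)) (σ (b : B)) ≤ c)
    (hB : ∀ b, LB b ≤ 1 → ∃ a, LA a ≤ 1 ∧ edist (ρ (a : A)) (σ (b : B)) ≤ c) :
    (pivotOneBridge hρ hσ).length LA LB ≤ c := by
  have hpivot (a : A) (b : B) (hab : edist (ρ a) (σ b) ≤ c) :
      edist (ρ a * 1) (1 * σ b) ≤ c := by
    rwa [mul_one, one_mul]
  refine max_le (hausdorffOf_le ?_ ?_) ((height_pivotOneBridge hρ hσ).trans_le zero_le)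
  · rintro _ ⟨a, ha, rfl⟩
    obtain ⟨b, hb, hab⟩ := hA a ha
    exact ⟨_, ⟨b, hb, rfl⟩, hpivot _ _ hab⟩
  · rintro _ ⟨b, hb, rfl⟩
    obtain ⟨a, ha, hab⟩ := hB b hb
    exact ⟨_, ⟨a, ha, rfl⟩, hpivot _ _ hab⟩

theorem propinquity_le_length {P Q : QLCQMS.{u}} (γ : Bridge P.carrier Q.carrier) :
    propinquity P Q ≤ γ.length P.L Q.L :=
  iInf_le_of_le (Trek.single γ) le_rfl

end PivotOne

/-! ### Comparison with the Gromov-Hausdorff distance -/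

section GromovHausdorff

open scoped NNReal

variable {X Y : Type u} {Z : Type*} [MetricSpace X] [CompactSpace X] [Nonempty X]
  [MetricSpace Y] [CompactSpace Y] [MetricSpace Z] {Φ : X → Z} {Ψ : Y → Z}

theorem exists_lipSeminorm_le_dist_le {ι : Type*} [Fintype ι] (hΦ : Isometry Φ) (hΨ : Isometry Ψ)
    {e : ι → ℝ} (he : ∀ i, e i = 0 ∨ e i = 1) {f : C(X, ι → ℝ)} {K : ℝ≥0}
    (hf : lipSeminorm e f ≤ K) :
    ∃ g : C(Y, ι → ℝ), lipSeminorm e g ≤ K ∧ ∀ x y, dist (f x) (g y) ≤ K * dist (Φ x) (Ψ y) := by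
  obtain ⟨hlip, hquot⟩ := max_le_iff.1 hf
  obtain ⟨r, -, hr⟩ := exists_abs_le_norm_enorm_sub_smul_eq he f
  have hrK : ‖f - r • ContinuousMap.const X e‖ ≤ K := ENNReal.coe_le_coe.1 (hr.trans_le hquot)
  obtain ⟨g, hg, hgf, hrange⟩ := exists_lipschitzWith_extension_pi hΦ (lipConst_le_coe_iff.1 hlip)
  have hgΨ : LipschitzWith K (g ∘ Ψ) := (hg.comp hΨ.lipschitz).weaken (mul_one K).le
  refine ⟨⟨g ∘ Ψ, hgΨ.continuous⟩, max_le (lipConst_le_coe_iff.2 hgΨ) ?_, fun x y => ?_⟩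
  · rw [enorm_mkQ_span_singleton]
    refine iInf_le_of_le r (ENNReal.coe_le_coe.2 ?_)
    refine (ContinuousMap.norm_le _ K.coe_nonneg).2 fun y => ?_
    have hclose := hrange (r • e) K (fun x => ?_) (Ψ y)
    · rwa [dist_eq_norm] at hclose
    · rw [dist_eq_norm]
      exact (ContinuousMap.norm_coe_le_norm _ x).trans hrK
  · rw [← hgf]
    exact hg.dist_le_mul _ _

variable {n : ℕ} {m : Fin (n + 1) → ℕ}

theorem exists_lipNorm_le_norm_sub_le (hΦ : Isometry Φ) (hΨ : Isometry Ψ)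
    {a : selfAdjoint C(X, FDAlg m)} {K : ℝ≥0} (ha : lipNorm m X a ≤ K) :
    ∃ b : selfAdjoint C(Y, FDAlg m), lipNorm m Y b ≤ K ∧
      ∀ x y, ‖a.1 x - b.1 y‖ ≤ √2 * maxSize m * (K * dist (Φ x) (Ψ y)) := by
  rw [lipNorm_eq_lipSeminorm_coords] at ha
  obtain ⟨g, hgK, hdist⟩ := exists_lipSeminorm_le_dist_le hΦ hΨ realCoords_one_eq_zero_or_one ha
  refine ⟨ofCoords g, (lipNorm_ofCoords_le g).trans hgK, fun x y => ?_⟩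
  have hax : a.1 x = ofRealCoords (coords a.1 x) := by
    rw [← ofCoords_apply, ofCoords_coords]
  rw [hax, ofCoords_apply, ← AddSubgroupClass.coe_sub, ← map_sub]
  refine (norm_ofRealCoords_le _).trans ?_
  rw [← dist_eq_norm]
  gcongr
  exact hdist x y

theorem injective_compStarAlgHom' {W V E : Type*} [TopologicalSpace W] [TopologicalSpace V]
    [NormedRing E] [StarRing E] [ContinuousStar E] [NormedAlgebra ℂ E] {f : C(W, V)}
    (hf : Function.Surjective f) : Function.Injective (f.compStarAlgHom' ℂ E) := fun _ _ h =>
  (ContinuousMap.cancel_right hf).1 h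

variable [Nontrivial (FDAlg m)] [Nonempty Y]

theorem propinquity_le_of_surjective {W : Type u} [TopologicalSpace W] [CompactSpace W]
    [Nonempty W] (hΦ : Isometry Φ) (hΨ : Isometry Ψ) {f : C(W, X)} (hf : Function.Surjective f)
    {g : C(W, Y)} (hg : Function.Surjective g) {δ : ℝ}
    (hδ : ∀ w, dist (Φ (f w)) (Ψ (g w)) ≤ δ) :
    propinquity (lipSpace m X) (lipSpace m Y) ≤
      ENNReal.ofReal (√2 * maxSize m * δ) := by
  have hδ₀ : 0 ≤ δ := dist_nonneg.trans (hδ (Classical.arbitrary W))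
  have hedist (a : C(X, FDAlg m)) (b : C(Y, FDAlg m))
      (hab : ∀ x y, ‖a x - b y‖ ≤ √2 * maxSize m * dist (Φ x) (Ψ y)) :
      edist (a.comp f) (b.comp g) ≤ ENNReal.ofReal (√2 * maxSize m * δ) := by
    rw [edist_dist]
    refine ENNReal.ofReal_le_ofReal ((ContinuousMap.dist_le (by positivity)).2 fun w => ?_)
    rw [dist_eq_norm]
    exact (hab _ _).trans (by gcongr; exact hδ w)
  refine (propinquity_le_length (P := lipSpace m X) (Q := lipSpace m Y)
    (pivotOneBridge (injective_compStarAlgHom' hf) (injective_compStarAlgHom' hg))).trans ?_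
  refine length_pivotOneBridge_le _ _ (fun a ha => ?_) fun b hb => ?_
  · obtain ⟨b, hb, hab⟩ := exists_lipNorm_le_norm_sub_le (K := 1) hΦ hΨ ha
    exact ⟨b, hb, hedist _ _ fun x y => by simpa using hab x y⟩
  · obtain ⟨a, ha, hba⟩ := exists_lipNorm_le_norm_sub_le (K := 1) hΨ hΦ hb
    refine ⟨a, ha, hedist _ _ fun x y => ?_⟩
    rw [norm_sub_rev, dist_comm]
    simpa using hba y x

theorem exists_dist_le_hausdorffDist {s t : Set Z} (hs : IsCompact s) (ht : IsCompact t)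
    (hne : t.Nonempty) {x : Z} (hx : x ∈ s) : ∃ y ∈ t, dist x y ≤ Metric.hausdorffDist s t := by
  obtain ⟨y, hy, hxy⟩ := ht.exists_infDist_eq_dist hne x
  refine ⟨y, hy, hxy ▸ Metric.infDist_le_hausdorffDist_of_mem hx ?_⟩
  exact Metric.hausdorffEDist_ne_top_of_nonempty_of_bounded ⟨x, hx⟩ hne hs.isBounded ht.isBounded

theorem propinquity_le_hausdorffDist (hΦ : Isometry Φ) (hΨ : Isometry Ψ) :
    propinquity (lipSpace m X) (lipSpace m Y) ≤
      ENNReal.ofReal (√2 * maxSize m * Metric.hausdorffDist (Set.range Φ) (Set.range Ψ)) := by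
  have hcptΦ := isCompact_range hΦ.continuous
  have hcptΨ := isCompact_range hΨ.continuous
  let W := {p : X × Y //
    dist (Φ p.1) (Ψ p.2) ≤ Metric.hausdorffDist (Set.range Φ) (Set.range Ψ)}
  have : CompactSpace W := by
    refine isCompact_iff_compactSpace.1 (IsClosed.isCompact ?_)
    exact isClosed_le ((hΦ.continuous.comp continuous_fst).dist
      (hΨ.continuous.comp continuous_snd)) continuous_const
  let f : C(W, X) := ⟨fun w => w.1.1, by fun_prop⟩
  let g : C(W, Y) := ⟨fun w => w.1.2, by fun_prop⟩
  have hf : Function.Surjective f := fun x => by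
    obtain ⟨_, ⟨y, rfl⟩, hxy⟩ := exists_dist_le_hausdorffDist hcptΦ hcptΨ (Set.range_nonempty Ψ)
      (Set.mem_range_self x)
    exact ⟨⟨(x, y), hxy⟩, rfl⟩
  have hg : Function.Surjective g := fun y => by
    obtain ⟨_, ⟨x, rfl⟩, hyx⟩ := exists_dist_le_hausdorffDist hcptΨ hcptΦ (Set.range_nonempty Φ)
      (Set.mem_range_self y)
    rw [Metric.hausdorffDist_comm, dist_comm] at hyx
    exact ⟨⟨(x, y), hyx⟩, rfl⟩
  have : Nonempty W := hf.nonempty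
  exact propinquity_le_of_surjective hΦ hΨ hf hg fun w => w.2

theorem propinquity_le_ghDist :
    propinquity (lipSpace m X) (lipSpace m Y) ≤
      ENNReal.ofReal (√2 * maxSize m * GromovHausdorff.ghDist X Y) := by
  rw [← GromovHausdorff.hausdorffDist_optimal]
  exact propinquity_le_hausdorffDist (GromovHausdorff.isometry_optimalGHInjl X Y)
    (GromovHausdorff.isometry_optimalGHInjr X Y)

end GromovHausdorff

/-! ### Isometry invariance and continuity -/

section Continuity

variable {n : ℕ} {m : Fin (n + 1) → ℕ}

theorem lipNorm_comp_le {X Y : Type u} [MetricSpace X] [CompactSpace X] [MetricSpace Y]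
    [CompactSpace Y] {h : C(Y, X)} (hh : LipschitzWith 1 h) {a : selfAdjoint C(X, FDAlg m)}
    {b : selfAdjoint C(Y, FDAlg m)} (hab : b.1 = a.1.comp h) : lipNorm m Y b ≤ lipNorm m X a := by
  have hcoords : coords b.1 =
      (ContinuousLinearMap.id ℝ (RealEntry m → ℝ) : C(_, _)).comp ((coords a.1).comp h) := by
    rw [hab]
    rfl
  rw [lipNorm_eq_lipSeminorm_coords, lipNorm_eq_lipSeminorm_coords, hcoords]
  exact lipSeminorm_comp_le (fun _ => le_rfl) hh (realCoords 1) (coords a.1)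

theorem quantumIsometric_lipSpace [Nontrivial (FDAlg m)] {X Y : Type u} [MetricSpace X]
    [CompactSpace X] [Nonempty X] [MetricSpace Y] [CompactSpace Y] [Nonempty Y] (e : X ≃ᵢ Y) :
    QuantumIsometric (lipSpace m X) (lipSpace m Y) := by
  refine ⟨e.toHomeomorph.symm.compStarAlgEquiv' ℂ (FDAlg m), fun a => ?_⟩
  refine le_antisymm (lipNorm_comp_le (h := e.toHomeomorph.symm) e.symm.isometry.lipschitz rfl)
    (lipNorm_comp_le (h := e.toHomeomorph) e.isometry.lipschitz ?_)
  exact ContinuousMap.ext fun x =>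
    congrArg (a.1 : C(X, FDAlg m)).toFun (e.symm_apply_apply x).symm

theorem continuous_of_propinquity_le {α : Type*} [PseudoMetricSpace α] {f : α → QLCQMS.{u}} {K : ℝ}
    (hf : ∀ p q, propinquity (f p) (f q) ≤ ENNReal.ofReal (K * dist p q)) : Continuous f := by
  refine continuous_def.2 fun U hU => isOpen_iff_mem_nhds.2 fun p hp => ?_
  obtain ⟨ε, hε, hball⟩ := hU (f p) hp
  have hcont : Continuous fun q => ENNReal.ofReal (K * dist p q) :=
    ENNReal.continuous_ofReal.comp (by fun_prop)
  have hlim := hcont.tendsto p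
  rw [dist_self, mul_zero, ENNReal.ofReal_zero] at hlim
  filter_upwards [hlim.eventually_lt_const hε] with q hq
  exact hball _ ((hf p q).trans_lt hq)

/-- Representatives of points of the Gromov-Hausdorff space live in `Type`, and have to be lifted
to the universe of the quantum spaces. -/
def uliftRepIsometryEquiv (p : GromovHausdorff.GHSpace) : ULift.{u} p.Rep ≃ᵢ p.Rep :=
  ⟨Equiv.ulift, fun _ _ => rfl⟩

theorem toGHSpace_uliftRep (p : GromovHausdorff.GHSpace) :
    GromovHausdorff.toGHSpace (ULift.{u} p.Rep) = p :=
  (GromovHausdorff.toGHSpace_eq_toGHSpace_iff_isometryEquiv.2 ⟨uliftRepIsometryEquiv p⟩).trans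
    p.toGHSpace_rep

theorem ghDist_uliftRep (p q : GromovHausdorff.GHSpace) :
    GromovHausdorff.ghDist (ULift.{u} p.Rep) (ULift.{u} q.Rep) = dist p q := by
  rw [GromovHausdorff.ghDist, toGHSpace_uliftRep, toGHSpace_uliftRep]

theorem continuous_lipSpace_uliftRep [Nontrivial (FDAlg m)] :
    Continuous fun p : GromovHausdorff.GHSpace => lipSpace m (ULift.{u} p.Rep) :=
  continuous_of_propinquity_le fun p q => ghDist_uliftRep.{u} p q ▸ propinquity_le_ghDist

end Continuity

end QPropinquity

theorem mainTheorem2 {n : ℕ} (m : Fin (n + 1) → ℕ) (hm : ∀ l, 0 < m l) :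
    ∃ hL : ∀ (X : Type u) [MetricSpace X] [CompactSpace X] [Nonempty X],
        QPropinquity.IsQuasiLeibnizCQMS C(X, QPropinquity.FDAlg m)
          (Real.sqrt 2 * QPropinquity.maxSize m) 0 (QPropinquity.lipNorm m X),
      (∃ Γ : GromovHausdorff.GHSpace → QPropinquity.QLCQMSClass.{u},
        (∀ (X : Type u) [MetricSpace X] [CompactSpace X] [Nonempty X],
          Γ (GromovHausdorff.toGHSpace X) = ⟦QPropinquity.QLCQMS.of (hL X)⟧) ∧
        Continuous Γ) ∧
      ∀ (X Y : Type u) [MetricSpace X] [CompactSpace X] [Nonempty X]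
        [MetricSpace Y] [CompactSpace Y] [Nonempty Y],
        QPropinquity.propinquity (QPropinquity.QLCQMS.of (hL X)) (QPropinquity.QLCQMS.of (hL Y)) ≤
          ENNReal.ofReal
            (Real.sqrt 2 * QPropinquity.maxSize m * GromovHausdorff.ghDist X Y) := by
  have (l : Fin (n + 1)) : Nonempty (Fin (m l)) := ⟨⟨0, hm l⟩⟩
  refine ⟨fun _ => QPropinquity.isQuasiLeibnizCQMS_lipNorm,
    ⟨fun p => ⟦QPropinquity.lipSpace m (ULift.{u} p.Rep)⟧, fun X _ _ _ => ?_,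
      continuous_quot_mk.comp QPropinquity.continuous_lipSpace_uliftRep⟩,
    fun _ _ => QPropinquity.propinquity_le_ghDist⟩
  obtain ⟨e⟩ := GromovHausdorff.toGHSpace_eq_toGHSpace_iff_isometryEquiv.1
    (QPropinquity.toGHSpace_uliftRep.{u} (GromovHausdorff.toGHSpace X))
  exact Quotient.sound (QPropinquity.quantumIsometric_lipSpace e)
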